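/- Let $K$ be a field of characteristic $0$; all algebras are (not necessarily associative or unital) algebras over $K$. A Zinbiel algebra is an algebra $(A,\circ)$ satisfying $a\circ(b\circ c)=(a\circ b+b\circ a)\circ c$ for all $a,b,c\in A$; its minus-algebra $A^{(-)}$ is the vector space $A$ with the product $[a,b]=a\circ b-b\circ a$. A Tortkara algebra is an anticommutative algebra satisfying $(ab)(cb)=J(a,b,c)\,b$ for all $a,b,c$, where $J(a,b,c)=(ab)c+(bc)a+(ca)b$. Theorem. Every Tortkara algebra $B$ over $K$ that is generated as an algebra by two elements is special: there exist a Zinbiel algebra $A$ over $K$ and an injective algebra homomorphism $B\to A^{(-)}$. -/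

import Mathlib

universe u v

/-- A (right-)Zinbiel algebra: `a ∘ (b ∘ c) = (a ∘ b + b ∘ a) ∘ c`. The ambient structure is that of
a nonassociative algebra; the product is written `*`. -/
def IsZinbiel (A : Type*) [NonUnitalNonAssocRing A] : Prop :=
  ∀ a b c : A, a * (b * c) = (a * b + b * a) * c

/-- The Jacobian `J(a, b, c) = (ab)c + (bc)a + (ca)b`. -/
def jacobian {B : Type*} [NonUnitalNonAssocRing B] (a b c : B) : B :=
  a * b * c + b * c * a + c * a * b

/-- A Tortkara algebra: an anticommutative algebra with `(ab)(cb) = J(a, b, c) b`. -/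
structure IsTortkara (B : Type*) [NonUnitalNonAssocRing B] : Prop where
  anticomm : ∀ a b : B, a * b = -(b * a)
  tortkara : ∀ a b c : B, (a * b) * (c * b) = jacobian a b c * b

/-- The minus-algebra `A⁽⁻⁾`: the same vector space as `A`, with the commutator product
`[x, y] = x ∘ y - y ∘ x`. -/
def MinusAlgebra (A : Type*) : Type _ := A

namespace MinusAlgebra

variable {A : Type*}

/-- The identity map `A → A⁽⁻⁾`. -/
def of : A ≃ MinusAlgebra A := Equiv.refl A

instance [NonUnitalNonAssocRing A] : AddCommGroup (MinusAlgebra A) :=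
  inferInstanceAs (AddCommGroup A)

instance [NonUnitalNonAssocRing A] : Mul (MinusAlgebra A) where
  mul x y := of (of.symm x * of.symm y - of.symm y * of.symm x)

theorem of_add [NonUnitalNonAssocRing A] (x y : A) : of (x + y) = of x + of y := rfl

theorem of_mul_of [NonUnitalNonAssocRing A] (x y : A) :
    of x * of y = of (x * y - y * x) := rfl

theorem of_symm_mul [NonUnitalNonAssocRing A] (x y : MinusAlgebra A) :
    of.symm (x * y) = of.symm x * of.symm y - of.symm y * of.symm x := rfl

theorem of_symm_add [NonUnitalNonAssocRing A] (x y : MinusAlgebra A) :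
    of.symm (x + y) = of.symm x + of.symm y := rfl

theorem of_symm_zero [NonUnitalNonAssocRing A] : of.symm (0 : MinusAlgebra A) = (0 : A) := rfl

instance [NonUnitalNonAssocRing A] : NonUnitalNonAssocRing (MinusAlgebra A) where
  left_distrib x y z := by
    apply of.symm.injective
    simp only [of_symm_mul, of_symm_add, mul_add, add_mul]
    abel
  right_distrib x y z := by
    apply of.symm.injective
    simp only [of_symm_mul, of_symm_add, mul_add, add_mul]
    abel
  zero_mul x := by
    apply of.symm.injective
    simp only [of_symm_mul, of_symm_zero, mul_zero, zero_mul, sub_zero]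
  mul_zero x := by
    apply of.symm.injective
    simp only [of_symm_mul, of_symm_zero, mul_zero, zero_mul, sub_zero]

instance {K : Type*} [Semiring K] [NonUnitalNonAssocRing A] [Module K A] :
    Module K (MinusAlgebra A) :=
  inferInstanceAs (Module K A)

theorem of_smul {K : Type*} [Semiring K] [NonUnitalNonAssocRing A] [Module K A] (k : K) (x : A) :
    of (k • x) = k • of x := rfl

end MinusAlgebra

/-- An algebra `B` over `K` is special if, for some Zinbiel algebra `A` over `K`, it is
(isomorphic to) a subalgebra of the minus-algebra `A⁽⁻⁾`, i.e. there is an injective algebra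
homomorphism `B → A⁽⁻⁾`. -/
def IsSpecial (K : Type u) (B : Type v) [Field K] [NonUnitalNonAssocRing B] [Module K B] : Prop :=
  ∃ (A : Type (max u v)) (_ : NonUnitalNonAssocRing A) (_ : Module K A)
    (_ : IsScalarTower K A A) (_ : SMulCommClass K A A),
    IsZinbiel A ∧ ∃ φ : B →ₙₐ[K] MinusAlgebra A, Function.Injective φ

/-! Write x, y for the two letters. The free Zinbiel algebra A on x, y consists of the polynomials
without constant term in the shuffle algebra, with a ∘ b = ∫ a db; its commutator is `area`. Let L
be the space of polynomials in `areaSubmodule`, that is, those of the form αx + βy + u(xy - yx).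

In a Tortkara algebra, two elements and their left-normed monomials span a subalgebra
(`generatedSpan_mul_mem`). In L the letters and their left-normed monomials form a basis
(`linearIndependent_leftNormedCoeff`, `exists_fstSeries`). Hence the subalgebra of A⁽⁻⁾ × B
generated by the pairs of corresponding generators is the graph of a homomorphism from L onto B. Let
I be its kernel. It suffices that the ideal of A generated by I meets L only in I: then B embeds in
the minus-algebra of the quotient.

This ideal is the shuffle ideal J generated by I, because J is stable under appending a letter
(`IsAreaIdeal.app_mem`). Two facts control J ∩ L. Since L generates the shuffle algebra
(`degLE_le_areaSpan`) and l f = [l, f] + 2 f ∘ l, every element of J is an element of I plus an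
element of J whose derivatives lie in J (`IsAreaIdeal.exists_add_of_mem`). Moreover u(xy - yx) lies
in I for every u in J (`IsAreaIdeal.curl_mem`). So for p in J ∩ L one may subtract an element of I
and assume p = u(xy - yx) with ∂ᵧp = ux in J. If x is not in I, a final letter x can be cancelled in
J (`IsAreaIdeal.mem_of_app_mem`), so u is in J and p is in I. The condition on x is met by naming a
nonzero generator x.

Several inductions on degree need to invert E + m with m ≥ 1, where E = x∂ₓ + y∂ᵧ is the derivation
`euler`. On polynomials the eigenvalues of E are nonnegative integers, so characteristic 0 suffices.
-/

/-- Formal series in two noncommuting letters; a word is stored with its last letter first. -/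
def ShuffleSeries (K : Type u) : Type u := List Bool → K

/-! ### The shuffle algebra, the half-shuffle and its commutator. -/

namespace ShuffleSeries

variable {K : Type u}

@[ext] theorem ext {f g : ShuffleSeries K} (h : ∀ w, f w = g w) : f = g := funext h

variable [Field K]

instance : AddCommGroup (ShuffleSeries K) := inferInstanceAs (AddCommGroup (List Bool → K))
instance : Module K (ShuffleSeries K) := inferInstanceAs (Module K (List Bool → K))

@[simp] theorem add_apply (f g : ShuffleSeries K) (w : List Bool) : (f + g) w = f w + g w := rfl
@[simp] theorem zero_apply (w : List Bool) : (0 : ShuffleSeries K) w = 0 := rfl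
@[simp] theorem smul_apply (c : K) (f : ShuffleSeries K) (w : List Bool) :
    (c • f) w = c * f w := rfl

/-- Removal of the last letter `t`. -/
def der (t : Bool) : ShuffleSeries K →ₗ[K] ShuffleSeries K where
  toFun f := fun w => f (t :: w)
  map_add' _ _ := rfl
  map_smul' _ _ := rfl

/-- The constant term. -/
def aug : ShuffleSeries K →ₗ[K] K where
  toFun f := f []
  map_add' _ _ := rfl
  map_smul' _ _ := rfl

theorem apply_cons (f : ShuffleSeries K) (t : Bool) (w : List Bool) : f (t :: w) = der t f w := rfl

/-- A series is determined by its constant term and its derivatives. -/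
theorem ext_der {f g : ShuffleSeries K} (h0 : aug f = aug g) (h : ∀ t, der t f = der t g) :
    f = g := by
  ext w
  cases w with
  | nil => exact h0
  | cons t w => exact congrFun (h t) w

/-- The coefficients of the shuffle product. -/
def shuffleCoeff : List Bool → ShuffleSeries K → ShuffleSeries K → K
  | [], f, g => aug f * aug g
  | t :: w, f, g => shuffleCoeff w (der t f) g + shuffleCoeff w f (der t g)

instance : Mul (ShuffleSeries K) := ⟨fun f g w => shuffleCoeff w f g⟩
instance : One (ShuffleSeries K) := ⟨fun w => match w with | [] => 1 | _ :: _ => 0⟩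

@[simp] theorem aug_mul (f g : ShuffleSeries K) : aug (f * g) = aug f * aug g := rfl
@[simp] theorem der_mul (t : Bool) (f g : ShuffleSeries K) :
    der t (f * g) = der t f * g + f * der t g := rfl
@[simp] theorem aug_one : aug (1 : ShuffleSeries K) = 1 := rfl
@[simp] theorem der_one (t : Bool) : der t (1 : ShuffleSeries K) = 0 := rfl

theorem mul_comm' (f g : ShuffleSeries K) : f * g = g * f := by
  ext w
  induction w generalizing f g with
  | nil => exact mul_comm _ _
  | cons t w ih => simp only [apply_cons, der_mul, add_apply, ih, add_comm]

theorem add_mul' (f g h : ShuffleSeries K) : (f + g) * h = f * h + g * h := by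
  ext w
  induction w generalizing f g h with
  | nil => exact add_mul _ _ _
  | cons t w ih => simp only [apply_cons, der_mul, map_add, add_apply, ih]; ring

theorem smul_mul' (c : K) (f h : ShuffleSeries K) : (c • f) * h = c • (f * h) := by
  ext w
  induction w generalizing f h with
  | nil => exact mul_assoc _ _ _
  | cons t w ih =>
    simp only [apply_cons, der_mul, map_smul, add_apply, smul_apply, ih]; ring

theorem zero_mul' (h : ShuffleSeries K) : 0 * h = 0 := by
  simpa using smul_mul' (0 : K) 0 h

theorem one_mul' (f : ShuffleSeries K) : 1 * f = f := by
  ext w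
  induction w generalizing f with
  | nil => exact one_mul _
  | cons t w ih => simp only [apply_cons, der_mul, der_one, zero_mul', zero_add, ih]

theorem mul_assoc' (f g h : ShuffleSeries K) : f * g * h = f * (g * h) := by
  have mul_add' : ∀ f g h : ShuffleSeries K, f * (g + h) = f * g + f * h := fun f g h => by
    rw [mul_comm', add_mul', mul_comm' g, mul_comm' h]
  ext w
  induction w generalizing f g h with
  | nil => exact mul_assoc _ _ _
  | cons t w ih => simp only [apply_cons, der_mul, add_mul', mul_add', add_apply, ih]; ring

instance : CommRing (ShuffleSeries K) :=
  { (inferInstance : AddCommGroup (ShuffleSeries K)) with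
    mul_assoc := mul_assoc'
    one_mul := one_mul'
    mul_one := fun f => by rw [mul_comm', one_mul']
    left_distrib := fun f g h => by rw [mul_comm', add_mul', mul_comm' g, mul_comm' h]
    right_distrib := add_mul'
    zero_mul := zero_mul'
    mul_zero := fun f => by rw [mul_comm', zero_mul']
    mul_comm := mul_comm' }

instance : Algebra K (ShuffleSeries K) :=
  Algebra.ofModule smul_mul' fun c f g => by rw [mul_comm, smul_mul', mul_comm]

/-- The coefficients of the series `f` with the letter `t` appended. -/
def appCoeff (t : Bool) (f : ShuffleSeries K) : List Bool → K
  | [] => 0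
  | s :: w => if s = t then f w else 0

/-- Appending the letter `t`. -/
def app (t : Bool) : ShuffleSeries K →ₗ[K] ShuffleSeries K where
  toFun f := appCoeff t f
  map_add' f g := by
    ext w
    rcases w with - | ⟨s, w⟩
    · exact (add_zero (0 : K)).symm
    · change (if s = t then f w + g w else 0) =
        (if s = t then f w else 0) + (if s = t then g w else 0)
      split_ifs <;> simp
  map_smul' c f := by
    ext w
    rcases w with - | ⟨s, w⟩
    · exact (mul_zero c).symm
    · change (if s = t then c * f w else 0) = c * (if s = t then f w else 0)
      split_ifs <;> simp

@[simp] theorem aug_app (t : Bool) (f : ShuffleSeries K) : aug (app t f) = 0 := rfl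
theorem der_app (s t : Bool) (f : ShuffleSeries K) :
    der s (app t f) = if s = t then f else 0 := by
  ext w
  change (if s = t then f w else 0) = _
  split_ifs <;> rfl
@[simp] theorem der_app_self (t : Bool) (f : ShuffleSeries K) : der t (app t f) = f := by
  simp [der_app]
@[simp] theorem der_true_app_false (f : ShuffleSeries K) : der true (app false f) = 0 := by
  simp [der_app]
@[simp] theorem der_false_app_true (f : ShuffleSeries K) : der false (app true f) = 0 := by
  simp [der_app]

@[simp] theorem der_algebraMap (t : Bool) (c : K) :
    der t (algebraMap K (ShuffleSeries K) c) = 0 := by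
  rw [Algebra.algebraMap_eq_smul_one, map_smul, der_one, smul_zero]
@[simp] theorem aug_algebraMap (c : K) : aug (algebraMap K (ShuffleSeries K) c) = c := by
  rw [Algebra.algebraMap_eq_smul_one, map_smul, aug_one, smul_eq_mul, mul_one]

theorem eq_sum_app (f : ShuffleSeries K) :
    f = algebraMap K _ (aug f) + app true (der true f) + app false (der false f) := by
  apply ext_der
  · simp
  · rintro (_ | _) <;> simp

/-- The letter `t`. -/
def letter (t : Bool) : ShuffleSeries K := app t 1

@[simp] theorem aug_letter (t : Bool) : aug (letter t : ShuffleSeries K) = 0 := rfl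
@[simp] theorem der_letter_self (t : Bool) : der t (letter t : ShuffleSeries K) = 1 :=
  der_app_self t 1
@[simp] theorem der_true_letter_false : der true (letter false : ShuffleSeries K) = 0 :=
  der_true_app_false 1
@[simp] theorem der_false_letter_true : der false (letter true : ShuffleSeries K) = 0 :=
  der_false_app_true 1

/-- The half-shuffle `∫ a db`. -/
def half : ShuffleSeries K →ₗ[K] ShuffleSeries K →ₗ[K] ShuffleSeries K :=
  LinearMap.mk₂ K (fun a b => app true (a * der true b) + app false (a * der false b))
    (fun _ _ _ => by simp only [add_mul, map_add]; abel)
    (fun _ _ _ => by simp only [smul_mul_assoc, map_smul, smul_add])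
    (fun _ _ _ => by simp only [mul_add, map_add]; abel)
    (fun _ _ _ => by simp only [mul_smul_comm, map_smul, smul_add])

theorem half_def (a b : ShuffleSeries K) :
    half a b = app true (a * der true b) + app false (a * der false b) := rfl
@[simp] theorem aug_half (a b : ShuffleSeries K) : aug (half a b) = 0 := by simp [half_def]
@[simp] theorem der_half (t : Bool) (a b : ShuffleSeries K) :
    der t (half a b) = a * der t b := by
  cases t <;> simp [half_def]

/-- Integration by parts. A half-shuffle has no constant term, which forces the hypothesis. -/
theorem half_add_half_swap {a b : ShuffleSeries K} (h : aug a * aug b = 0) :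
    half a b + half b a = a * b := by
  apply ext_der
  · simp [h]
  · intro t; simp; ring

theorem half_half {a b : ShuffleSeries K} (h : aug a * aug b = 0) (c : ShuffleSeries K) :
    half a (half b c) = half (half a b + half b a) c := by
  rw [half_add_half_swap h]
  apply ext_der
  · simp
  · intro t; simp [mul_assoc]

/-- The commutator of the half-shuffle. -/
def area : ShuffleSeries K →ₗ[K] ShuffleSeries K →ₗ[K] ShuffleSeries K := half - half.flip

theorem area_def (a b : ShuffleSeries K) : area a b = half a b - half b a := rfl
@[simp] theorem aug_area (a b : ShuffleSeries K) : aug (area a b) = 0 := by simp [area_def]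
@[simp] theorem der_area (t : Bool) (a b : ShuffleSeries K) :
    der t (area a b) = a * der t b - b * der t a := by simp [area_def]

/-- The map `u ↦ u (xy - yx)`, where `x` and `y` are the letters `true` and `false`. -/
def curl : ShuffleSeries K →ₗ[K] ShuffleSeries K :=
  app false ∘ₗ app true - app true ∘ₗ app false

theorem curl_def (u : ShuffleSeries K) :
    curl u = app false (app true u) - app true (app false u) := rfl
@[simp] theorem aug_curl (u : ShuffleSeries K) : aug (curl u) = 0 := by simp [curl_def]
@[simp] theorem der_true_curl (u : ShuffleSeries K) : der true (curl u) = -app false u := by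
  simp [curl_def]
@[simp] theorem der_false_curl (u : ShuffleSeries K) : der false (curl u) = app true u := by
  simp [curl_def]

/-! ### The degree filtration; degrees are integers, so that derivatives lower them without
truncation. -/

/-- The series of degree at most `n`. -/
def degLE (K : Type u) [Field K] (n : ℤ) : Submodule K (ShuffleSeries K) where
  carrier := {f | ∀ w : List Bool, n < w.length → f w = 0}
  add_mem' hf hg w hw := by simp [hf w hw, hg w hw]
  zero_mem' _ _ := rfl
  smul_mem' c f hf w hw := by simp [hf w hw]

theorem degLE_mono {m n : ℤ} (h : m ≤ n) : degLE K m ≤ degLE K n :=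
  fun _ hf w hw => hf w (h.trans_lt hw)

theorem eq_zero_of_mem_degLE_neg {n : ℤ} (h : n < 0) {f : ShuffleSeries K} (hf : f ∈ degLE K n) :
    f = 0 := by
  ext w; exact hf w (by omega)

theorem der_mem_degLE {n : ℤ} (t : Bool) {f : ShuffleSeries K} (hf : f ∈ degLE K n) :
    der t f ∈ degLE K (n - 1) :=
  fun w hw => hf (t :: w) (by simp only [List.length_cons]; push_cast; omega)

theorem app_mem_degLE {n : ℤ} (t : Bool) {f : ShuffleSeries K} (hf : f ∈ degLE K n) :
    app t f ∈ degLE K (n + 1) := by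
  intro w hw
  cases w with
  | nil => rfl
  | cons s w =>
    change der s (app t f) w = 0
    rw [der_app]
    split_ifs
    · exact hf w (by simp only [List.length_cons] at hw; push_cast at hw; omega)
    · rfl

theorem algebraMap_mem_degLE (c : K) : algebraMap K (ShuffleSeries K) c ∈ degLE K 0 := by
  intro w hw
  cases w with
  | nil => simp at hw
  | cons s w => change der s (algebraMap K _ c) w = 0; rw [der_algebraMap]; rfl

theorem one_mem_degLE : (1 : ShuffleSeries K) ∈ degLE K 0 := by
  simpa using algebraMap_mem_degLE (1 : K)

theorem letter_mem_degLE (t : Bool) : (letter t : ShuffleSeries K) ∈ degLE K 1 :=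
  app_mem_degLE t one_mem_degLE

theorem mul_mem_degLE {m n : ℤ} {f g : ShuffleSeries K} (hf : f ∈ degLE K m)
    (hg : g ∈ degLE K n) : f * g ∈ degLE K (m + n) := by
  intro w hw
  induction w generalizing f g m n with
  | nil =>
    change aug (f * g) = 0
    rw [aug_mul]
    simp at hw
    rcases lt_or_ge m 0 with h | h
    · rw [eq_zero_of_mem_degLE_neg h hf]; simp
    · rw [eq_zero_of_mem_degLE_neg (n := n) (by omega) hg]; simp
  | cons t w ih =>
    simp only [List.length_cons] at hw
    push_cast at hw
    change der t (f * g) w = 0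
    rw [der_mul, add_apply, ih (der_mem_degLE t hf) hg (by omega),
      ih hf (der_mem_degLE t hg) (by omega), add_zero]

theorem half_mem_degLE {m n : ℤ} {f g : ShuffleSeries K} (hf : f ∈ degLE K m)
    (hg : g ∈ degLE K n) : half f g ∈ degLE K (m + n) := by
  have := fun t => app_mem_degLE t (mul_mem_degLE hf (der_mem_degLE t hg))
  rw [show m + (n - 1) + 1 = m + n by ring] at this
  exact add_mem (this true) (this false)

theorem area_mem_degLE {m n : ℤ} {f g : ShuffleSeries K} (hf : f ∈ degLE K m)
    (hg : g ∈ degLE K n) : area f g ∈ degLE K (m + n) :=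
  sub_mem (half_mem_degLE hf hg) (add_comm n m ▸ half_mem_degLE hg hf)

theorem curl_mem_degLE {m : ℤ} {f : ShuffleSeries K} (hf : f ∈ degLE K m) :
    curl f ∈ degLE K (m + 2) := by
  have := fun s t => app_mem_degLE s (app_mem_degLE t hf)
  rw [show m + 1 + 1 = m + 2 by ring] at this
  exact sub_mem (this _ _) (this _ _)

theorem eq_algebraMap_of_mem_degLE_zero {f : ShuffleSeries K} (hf : f ∈ degLE K 0) :
    f = algebraMap K _ (aug f) := by
  have h := fun t => eq_zero_of_mem_degLE_neg (by norm_num) (der_mem_degLE t hf)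
  conv_lhs => rw [eq_sum_app f, h, h]
  simp

/-! ### The Euler derivation E and the invertibility of E + m on polynomials. -/

/-- The derivation `f ↦ x ∂ₓf + y ∂ᵧf`. -/
def euler : ShuffleSeries K →ₗ[K] ShuffleSeries K where
  toFun f := letter true * der true f + letter false * der false f
  map_add' _ _ := by simp only [map_add]; ring
  map_smul' _ _ := by simp only [map_smul, mul_smul_comm, smul_add, RingHom.id_apply]

theorem euler_def (f : ShuffleSeries K) :
    euler f = letter true * der true f + letter false * der false f := rfl
theorem euler_mul (f g : ShuffleSeries K) : euler (f * g) = euler f * g + f * euler g := by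
  simp only [euler_def, der_mul]; ring
@[simp] theorem euler_letter (t : Bool) : euler (letter t : ShuffleSeries K) = letter t := by
  cases t <;> simp [euler_def]
@[simp] theorem euler_one : euler (1 : ShuffleSeries K) = 0 := by simp [euler_def]

/-- The operators `f ↦ ∑ c x_{t₁} ⋯ x_{tₖ} ∂_{tₖ} ⋯ ∂_{t₁} f`. -/
def eulerIter : ℕ → ShuffleSeries K → ShuffleSeries K → ShuffleSeries K
  | 0, c, f => c * f
  | k + 1, c, f => eulerIter k (letter true * c) (der true f) +
      eulerIter k (letter false * c) (der false f)

theorem eulerIter_succ (k : ℕ) (c f : ShuffleSeries K) :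
    eulerIter (k + 1) c f = eulerIter k (letter true * c) (der true f) +
      eulerIter k (letter false * c) (der false f) := rfl

/-- For c = 1 and j = 0 this reads Eₖ₊₁ = (E - k) Eₖ, so Eₖ = E(E - 1)⋯(E - k + 1). As Eₖ vanishes
in degree below k, E is annihilated on degree at most n by a polynomial with roots 0, …, n. The
general c is needed because the recursion of `eulerIter` changes c. -/
theorem euler_eulerIter (k j : ℕ) (c f : ShuffleSeries K) (hc : euler c = (j : K) • c) :
    euler (eulerIter k c f) = ((j + k : ℕ) : K) • eulerIter k c f + eulerIter (k + 1) c f := by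
  induction k generalizing j c f with
  | zero =>
    simp only [eulerIter, euler_mul, hc, add_zero, euler_def f, smul_mul_assoc]; ring
  | succ k ih =>
    have h : ∀ t, euler (letter t * c) = ((j + 1 : ℕ) : K) • (letter t * c) := fun t => by
      rw [euler_mul, hc, euler_letter]; push_cast
      rw [add_smul, one_smul, mul_smul_comm, add_comm]
    conv_lhs => rw [eulerIter]
    rw [map_add, ih _ _ _ (h true), ih _ _ _ (h false), eulerIter_succ (k + 1),
      eulerIter_succ k c f, smul_add, show j + 1 + k = j + (k + 1) by ring]
    abel

theorem eulerIter_zero_right (k : ℕ) (c : ShuffleSeries K) : eulerIter k c 0 = 0 := by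
  induction k generalizing c with
  | zero => simp [eulerIter]
  | succ k ih => simp [eulerIter, ih]

theorem eulerIter_eq_zero (k : ℕ) {n : ℤ} (h : n < k) (c : ShuffleSeries K) {f : ShuffleSeries K}
    (hf : f ∈ degLE K n) : eulerIter k c f = 0 := by
  induction k generalizing n c f with
  | zero => rw [eq_zero_of_mem_degLE_neg (by simpa using h) hf, eulerIter_zero_right]
  | succ k ih =>
    have := fun t => ih (n := n - 1) (by push_cast at h; omega) (letter t * c) (der_mem_degLE t hf)
    simp [eulerIter, this]

theorem eulerIter_mem_degLE (k : ℕ) {m n : ℤ} {c f : ShuffleSeries K} (hc : c ∈ degLE K m)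
    (hf : f ∈ degLE K n) : eulerIter k c f ∈ degLE K (m + n) := by
  induction k generalizing m n c f with
  | zero => exact mul_mem_degLE hc hf
  | succ k ih =>
    have := fun t => ih (mul_mem_degLE (letter_mem_degLE t) hc) (der_mem_degLE t hf)
    rw [show 1 + m + (n - 1) = m + n by ring] at this
    exact add_mem (this true) (this false)

variable [CharZero K]

theorem exists_euler_add_smul (m : ℕ) {n : ℤ} {z : ShuffleSeries K} (hz : z ∈ degLE K n) :
    ∃ z' ∈ degLE K n, euler z' + ((m + 1 : ℕ) : K) • z' = z := by
  -- Descending induction on k, with d bounding the number of steps until Eₖz = 0. From (E + m +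
  -- 1)Eₖz = (m + 1 + k)Eₖz + Eₖ₊₁z, a preimage of Eₖ₊₁z yields one of Eₖz.
  have key : ∀ d k : ℕ, n < k + d →
      ∃ z' ∈ degLE K n, euler z' + ((m + 1 : ℕ) : K) • z' = eulerIter k 1 z := by
    intro d
    induction d with
    | zero =>
      intro k hk
      exact ⟨0, zero_mem _, by rw [eulerIter_eq_zero k (by simpa using hk) 1 hz]; simp⟩
    | succ d ih =>
      intro k hk
      obtain ⟨z', hz', h⟩ := ih (k + 1) (by push_cast at hk ⊢; omega)
      have h1 := euler_eulerIter k 0 1 z (by simp)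
      have hm : eulerIter k 1 z ∈ degLE K n := by
        simpa using eulerIter_mem_degLE k one_mem_degLE hz
      have h0 : ((m + 1 + k : ℕ) : K) ≠ 0 := by
        exact_mod_cast (by omega : m + 1 + k ≠ 0)
      refine ⟨((m + 1 + k : ℕ) : K)⁻¹ • (eulerIter k 1 z - z'),
        Submodule.smul_mem _ _ (sub_mem hm hz'), ?_⟩
      rw [map_smul, smul_comm _ (((m + 1 + k : ℕ) : K)⁻¹), ← smul_add, inv_smul_eq_iff₀ h0,
        map_sub, h1, smul_sub]
      rw [← h, zero_add]
      push_cast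
      module
  have := key (n.toNat + 1) 0 (by push_cast; omega)
  simpa [eulerIter] using this

theorem eq_zero_of_euler_add_smul (m : ℕ) {n : ℤ} {z : ShuffleSeries K} (hz : z ∈ degLE K n)
    (h : euler z + ((m + 1 : ℕ) : K) • z = 0) : z = 0 := by
  have lin : ∀ (k : ℕ) (c : ShuffleSeries K), ∃ φ : ShuffleSeries K →ₗ[K] ShuffleSeries K,
      ∀ f, φ f = eulerIter k c f := by
    intro k
    induction k with
    | zero => exact fun c => ⟨LinearMap.mulLeft K c, fun f => rfl⟩
    | succ k ih =>
      intro c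
      obtain ⟨φ, hφ⟩ := ih (letter true * c)
      obtain ⟨ψ, hψ⟩ := ih (letter false * c)
      exact ⟨φ ∘ₗ der true + ψ ∘ₗ der false, fun f => by simp [eulerIter, hφ, hψ]⟩
  -- If Ez = -(m + 1)z, each factor E - k acts on z by the nonzero scalar -(m + 1 + k), while Eₖz =
  -- 0 for large k.
  have key : ∀ k : ℕ, ∃ r : K, r ≠ 0 ∧ eulerIter k 1 z = r • z := by
    intro k
    induction k with
    | zero => exact ⟨1, one_ne_zero, by simp [eulerIter]⟩
    | succ k ih =>
      obtain ⟨r, hr, hk⟩ := ih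
      have h1 := euler_eulerIter k 0 1 z (by simp)
      refine ⟨-(r * (m + 1 + k : ℕ)), neg_ne_zero.2 (mul_ne_zero hr
        (by exact_mod_cast (by omega : m + 1 + k ≠ 0))), ?_⟩
      rw [hk, map_smul, eq_neg_of_add_eq_zero_left h] at h1
      rw [← sub_eq_iff_eq_add'.2 h1]
      push_cast
      module
  obtain ⟨r, hr, hk⟩ := key (n.toNat + 1)
  rw [eulerIter_eq_zero _ (by push_cast; omega) 1 hz] at hk
  exact (smul_eq_zero.1 hk.symm).resolve_left hr

end ShuffleSeries

/-! ### Left-normed monomials span two-generated Tortkara algebras. -/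

/-- The left-normed monomials `((g true * g false) * g t₁) * ⋯`; the last factor comes first in the
list. -/
def leftNormed {P : Type*} [Mul P] (g : Bool → P) : List Bool → P
  | [] => g true * g false
  | t :: w => leftNormed g w * g t

/-- The span of the left-normed monomials with `n + 2` factors. -/
def leftNormedSpan (K : Type*) {P : Type*} [Semiring K] [NonUnitalNonAssocRing P] [Module K P]
    (g : Bool → P) (n : ℕ) : Submodule K P :=
  Submodule.span K (leftNormed g '' {w | w.length = n})

namespace IsTortkara

variable {P : Type*} [NonUnitalNonAssocRing P]

/-- Polarization of the Tortkara identity in its repeated variable. -/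
theorem linearized (h : IsTortkara P) (a b c d : P) :
    (a * b) * (c * d) + (a * d) * (c * b) = jacobian a b c * d + jacobian a d c * b := by
  have h1 := h.tortkara a (b + d) c
  have h2 := h.tortkara a b c
  have h3 := h.tortkara a d c
  have e : jacobian a (b + d) c = jacobian a b c + jacobian a d c := by
    simp only [jacobian, mul_add, add_mul]; abel
  rw [e] at h1
  simp only [mul_add, add_mul] at h1
  rw [h2, h3] at h1
  rw [← sub_eq_zero, ← sub_eq_zero.2 h1]
  abel

variable {K : Type*} [Field K] [Module K P]

theorem leftNormed_mem_span (g : Bool → P) {w : List Bool} {n : ℕ} (hn : w.length = n) :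
    leftNormed g w ∈ leftNormedSpan K g n :=
  Submodule.subset_span ⟨w, hn, rfl⟩

theorem mul_mem_leftNormedSpan [IsScalarTower K P P] (g : Bool → P) {n : ℕ} {p : P} (hp : p ∈ leftNormedSpan K g n)
    (t : Bool) : p * g t ∈ leftNormedSpan K g (n + 1) := by
  induction hp using Submodule.span_induction with
  | mem p hp =>
    obtain ⟨w, hw, rfl⟩ := hp
    exact leftNormed_mem_span (w := t :: w) g (by simpa using hw)
  | zero => simp
  | add p q _ _ hp hq => rw [add_mul]; exact add_mem hp hq
  | smul c p _ hp => rw [smul_mul_assoc]; exact Submodule.smul_mem _ _ hp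

/-- To show that multiplication by `a` maps left-normed elements to a submodule, it suffices to
consider monomials. -/
theorem mul_mem_of_leftNormed [SMulCommClass K P P] (g : Bool → P) {n : ℕ} {a : P} {S : Submodule K P}
    (h : ∀ w : List Bool, w.length = n → a * leftNormed g w ∈ S) {p : P}
    (hp : p ∈ leftNormedSpan K g n) : a * p ∈ S := by
  induction hp using Submodule.span_induction with
  | mem p hp => obtain ⟨w, hw, rfl⟩ := hp; exact h w hw
  | zero => simp
  | add p q _ _ hp hq => rw [mul_add]; exact add_mem hp hq
  | smul c p _ hp => rw [mul_smul_comm]; exact Submodule.smul_mem _ _ hp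

variable [CharZero K]

theorem mul_self (K : Type*) [Field K] [CharZero K] [Module K P] (h : IsTortkara P) (a : P) :
    a * a = 0 := by
  have h2 : (2 : K) • (a * a) = 0 := by
    rw [two_smul]; nth_rw 1 [h.anticomm]; exact neg_add_cancel _
  exact (smul_eq_zero.1 h2).resolve_left two_ne_zero

variable [IsScalarTower K P P]

theorem leftNormed_nil_mul_mem (h : IsTortkara P) (g : Bool → P) (v : List Bool) (s t : Bool) :
    g s * g t * leftNormed g v ∈ leftNormedSpan K g (v.length + 2) := by
  induction v generalizing s t with
  | nil =>
    have : g s * g t * leftNormed g [] = 0 := by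
      cases s <;> cases t <;> simp only [leftNormed, mul_self K h, zero_mul]
      rw [h.anticomm (g false), neg_mul, mul_self K h, neg_zero]
    rw [this]; exact zero_mem _
  | cons r v ih =>
    -- When the second letter is the last letter r of the monomial, the Tortkara identity pulls r
    -- out on the right, and each term of the Jacobian involves only the shorter monomial.
    have key : ∀ s, g s * g r * (leftNormed g v * g r) ∈
        leftNormedSpan K g (v.length + 1 + 2) := by
      intro s
      rw [h.tortkara, jacobian]
      apply mul_mem_leftNormedSpan
      have hv : ∀ t, leftNormed g v * g t ∈ leftNormedSpan K g (v.length + 1) :=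
        mul_mem_leftNormedSpan g (leftNormed_mem_span g rfl)
      refine add_mem (add_mem (ih s r) ?_) (mul_mem_leftNormedSpan g (hv s) r)
      rw [h.anticomm (g r), neg_mul]
      exact neg_mem (mul_mem_leftNormedSpan g (hv r) s)
    change g s * g t * (leftNormed g v * g r) ∈ leftNormedSpan K g (v.length + 1 + 2)
    by_cases hs : s = t
    · rw [hs, mul_self K h, zero_mul]; exact zero_mem _
    -- There are only two letters, so distinct s and t cannot both differ from r.
    · by_cases ht : t = r
      · exact ht ▸ key s
      · have : s = r := by cases s <;> cases t <;> cases r <;> simp_all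
        rw [h.anticomm (g s), neg_mul, this]
        exact neg_mem (key t)

variable [SMulCommClass K P P]

/-- Induction on the length of u, then of v. For (U s)(V t) with s = t the Tortkara identity pulls
out the last letter. For s ≠ t its linearization trades the product for one with the factor s t,
covered by `leftNormed_nil_mul_mem`, for Jacobian terms followed by t, and for the product of the
shorter U with a left-normed element. -/
theorem leftNormed_mul_mem (h : IsTortkara P) (g : Bool → P) (k : ℕ) :
    ∀ (u v : List Bool), u.length = k →
      leftNormed g u * leftNormed g v ∈ leftNormedSpan K g (k + v.length + 2) := by
  induction k using Nat.strong_induction_on with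
  | _ k ih =>
  intro u v hu
  rcases u with - | ⟨s, u⟩
  · simp only [List.length_nil] at hu
    subst hu
    rw [zero_add]
    exact leftNormed_nil_mul_mem h g v true false
  obtain ⟨k, rfl⟩ : ∃ j, k = j + 1 := ⟨u.length, by simpa using hu.symm⟩
  simp only [List.length_cons, add_left_inj] at hu
  have ihs : ∀ {m n : ℕ} {p : P}, p ∈ leftNormedSpan K g m → n = k + m + 2 →
      leftNormed g u * p ∈ leftNormedSpan K g n := fun {m n p} hp hn =>
    mul_mem_of_leftNormed g (fun w hw => by subst hw hn; exact ih k (by omega) u w hu) hp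
  have ih0 : ∀ {m n : ℕ} {p : P} (s t : Bool), p ∈ leftNormedSpan K g m → n = m + 2 →
      g s * g t * p ∈ leftNormedSpan K g n := fun {m n p} s t hp hn =>
    mul_mem_of_leftNormed g (fun w hw => by subst hw hn; exact leftNormed_nil_mul_mem h g w s t) hp
  have hg : ∀ {m n : ℕ} {p : P} (t : Bool), p ∈ leftNormedSpan K g m → n = m + 1 →
      p * g t ∈ leftNormedSpan K g n := fun t hp hn => hn ▸ mul_mem_leftNormedSpan g hp t
  have hU : leftNormed g u ∈ leftNormedSpan K g k := leftNormed_mem_span g hu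
  induction v generalizing s with
  | nil =>
    rw [h.anticomm]
    exact neg_mem (ih0 true false (hg s hU rfl) (by simp))
  | cons t v ihv =>
    have hV : leftNormed g v ∈ leftNormedSpan K g v.length := leftNormed_mem_span g rfl
    simp only [List.length_cons]
    change leftNormed g u * g s * (leftNormed g v * g t) ∈ _
    by_cases hst : s = t
    · subst hst
      rw [h.tortkara, jacobian]
      refine hg s (m := k + v.length + 3) (add_mem (add_mem ?_ ?_) ?_) (by omega)
      · have := ihv s
        rwa [show k + 1 + v.length + 2 = k + v.length + 3 by omega] at this
      · rw [h.anticomm (g s), neg_mul, h.anticomm, neg_neg]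
        exact ihs (hg s hV rfl) (by omega)
      · rw [h.anticomm (leftNormed g v), neg_mul]
        exact neg_mem (hg s (ihs hV rfl) (by omega))
    · have e := h.linearized (g s) (leftNormed g u) (leftNormed g v) (g t)
      have e' : leftNormed g u * g s * (leftNormed g v * g t) =
          -(g s * g t * (leftNormed g u * leftNormed g v)) -
            jacobian (g s) (leftNormed g u) (leftNormed g v) * g t +
            leftNormed g u * jacobian (g s) (g t) (leftNormed g v) := by
        rw [h.anticomm (leftNormed g u) (g s), neg_mul, h.anticomm (leftNormed g u) (jacobian _ _ _),
          h.anticomm (leftNormed g u) (leftNormed g v), mul_neg, eq_sub_of_add_eq e]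
        abel
      rw [e']
      refine add_mem (sub_mem (neg_mem (ih0 s t (ihs hV rfl) (by omega))) ?_) (ihs (m := v.length + 2)
        ?_ (by omega))
      · refine hg t (m := k + v.length + 3) (add_mem (add_mem ?_ ?_) ?_) (by omega)
        · rw [h.anticomm (g s), neg_mul]
          have := ihv s
          rw [show k + 1 + v.length + 2 = k + v.length + 3 by omega] at this
          exact neg_mem this
        · exact hg s (ihs hV rfl) (by omega)
        · rw [h.anticomm]
          exact neg_mem (ihs (hg s hV rfl) (by omega))
      · refine add_mem (add_mem (ih0 s t hV rfl) ?_) (hg t (hg s hV rfl) rfl)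
        rw [h.anticomm (g t), neg_mul]
        exact neg_mem (hg s (hg t hV rfl) rfl)

/-- The span of the generators and the left-normed monomials. -/
def generatedSpan (K : Type*) [Field K] [Module K P] (g : Bool → P) : Submodule K P :=
  Submodule.span K (Set.range g ∪ Set.range (leftNormed g))

theorem generatedSpan_mul_mem (h : IsTortkara P) (g : Bool → P) {p q : P}
    (hp : p ∈ generatedSpan K g) (hq : q ∈ generatedSpan K g) : p * q ∈ generatedSpan K g := by
  have hM : ∀ w, leftNormed g w ∈ generatedSpan K g := fun w =>
    Submodule.subset_span (Or.inr ⟨w, rfl⟩)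
  have hle : ∀ n, leftNormedSpan K g n ≤ generatedSpan K g := fun n =>
    Submodule.span_le.2 (by rintro _ ⟨w, -, rfl⟩; exact hM w)
  induction hp using Submodule.span_induction with
  | zero => simp
  | add p p' _ _ hp hp' => rw [add_mul]; exact add_mem hp hp'
  | smul c p _ hp => rw [smul_mul_assoc]; exact Submodule.smul_mem _ _ hp
  | mem p hp =>
    induction hq using Submodule.span_induction with
    | zero => simp
    | add q q' _ _ hq hq' => rw [mul_add]; exact add_mem hq hq'
    | smul c q _ hq => rw [mul_smul_comm]; exact Submodule.smul_mem _ _ hq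
    | mem q hq =>
      rcases hp with ⟨s, rfl⟩ | ⟨u, rfl⟩ <;> rcases hq with ⟨t, rfl⟩ | ⟨v, rfl⟩
      · cases s <;> cases t
        · rw [mul_self K h]; exact zero_mem _
        · rw [h.anticomm]; exact neg_mem (hM [])
        · exact hM []
        · rw [mul_self K h]; exact zero_mem _
      · rw [h.anticomm]; exact neg_mem (hM (s :: v))
      · exact hM (t :: u)
      · exact hle _ (leftNormed_mul_mem h g _ u v rfl)

end IsTortkara

/-! ### The area subalgebra and its description by `curl`. -/

namespace ShuffleSeries

variable {K : Type u} [Field K]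

/-- The series without constant term that are killed by the symmetric second derivatives. -/
def areaSubmodule (K : Type u) [Field K] : Submodule K (ShuffleSeries K) where
  carrier := {f | aug f = 0 ∧ ∀ s t, der s (der t f) + der t (der s f) = 0}
  add_mem' hf hg := ⟨by simp [hf.1, hg.1], fun s t => by
    have h1 := hf.2 s t
    have h2 := hg.2 s t
    simp only [map_add]
    linear_combination h1 + h2⟩
  zero_mem' := ⟨map_zero _, fun _ _ => by simp⟩
  smul_mem' c f hf := ⟨by simp [hf.1], fun s t => by
    simp only [map_smul, ← smul_add, hf.2, smul_zero]⟩

theorem der_false_der_true {f : ShuffleSeries K} (hf : f ∈ areaSubmodule K) :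
    der false (der true f) = -der true (der false f) :=
  eq_neg_of_add_eq_zero_left (hf.2 _ _)

theorem area_mem {a b : ShuffleSeries K} (ha : a ∈ areaSubmodule K) (hb : b ∈ areaSubmodule K) :
    area a b ∈ areaSubmodule K := by
  refine ⟨aug_area _ _, fun s t => ?_⟩
  have h1 := ha.2 s t
  have h2 := hb.2 s t
  simp only [der_area, map_sub, der_mul]
  linear_combination a * h2 - b * h1

theorem letter_mem (t : Bool) : letter t ∈ areaSubmodule K :=
  ⟨rfl, fun r s => by cases t <;> cases r <;> cases s <;> simp⟩

theorem curl_mem (u : ShuffleSeries K) : curl u ∈ areaSubmodule K :=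
  ⟨aug_curl u, fun r s => by cases r <;> cases s <;> simp⟩

/-- Taking u = ∂ₜz and summing over t gives, up to sign, `curl` of (E + 1)z minus the constant term
of z. This is how E + 1 governs left-normed monomials. -/
theorem area_curl_letter (u : ShuffleSeries K) (t : Bool) :
    area (curl u) (letter t) = -curl (letter t * u + app t u) := by
  apply ext_der
  · simp
  · intro s
    apply ext_der
    · cases s <;> cases t <;> simp
    · intro r
      cases s <;> cases t <;> cases r <;> simp <;> ring

theorem area_letters : area (letter true) (letter false) = (curl 1 : ShuffleSeries K) := by
  apply ext_der
  · simp
  · intro s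
    cases s <;> simp [letter]

theorem curl_injective : Function.Injective (curl : ShuffleSeries K →ₗ[K] _) := by
  intro u v h
  have := congrArg (fun f => der true (der false f)) h
  simpa using this

variable [CharZero K]

theorem der_der_self (t : Bool) {f : ShuffleSeries K} (hf : f ∈ areaSubmodule K) :
    der t (der t f) = 0 := by
  have h2 : (2 : K) • der t (der t f) = 0 := by rw [two_smul]; exact hf.2 t t
  exact (smul_eq_zero.1 h2).resolve_left two_ne_zero

theorem der_true_eq {f : ShuffleSeries K} (hf : f ∈ areaSubmodule K) :
    der true f = algebraMap K _ (aug (der true f)) - app false (der true (der false f)) := by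
  conv_lhs => rw [eq_sum_app (der true f), der_der_self true hf, der_false_der_true hf]
  simp [sub_eq_add_neg]

theorem der_false_eq {f : ShuffleSeries K} (hf : f ∈ areaSubmodule K) :
    der false f = algebraMap K _ (aug (der false f)) + app true (der true (der false f)) := by
  conv_lhs => rw [eq_sum_app (der false f), der_der_self false hf]
  simp

/-- The repeated second derivatives vanish and the mixed ones are opposite, so the linear
coefficients and a single mixed derivative determine f. -/
theorem eq_curl_of_mem {f : ShuffleSeries K} (hf : f ∈ areaSubmodule K) :
    f = aug (der true f) • letter true + aug (der false f) • letter false +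
      curl (der true (der false f)) := by
  apply ext_der
  · simp [hf.1]
  · rintro (_ | _)
    · conv_lhs => rw [der_false_eq hf]
      simp [Algebra.algebraMap_eq_smul_one]
    · conv_lhs => rw [der_true_eq hf]
      simp [Algebra.algebraMap_eq_smul_one, sub_eq_add_neg]

theorem eq_curl_of_aug_der {f : ShuffleSeries K} (hf : f ∈ areaSubmodule K)
    (h : ∀ t, aug (der t f) = 0) : f = curl (der true (der false f)) := by
  conv_lhs => rw [eq_curl_of_mem hf]
  simp [h]

/-- For f in an area ideal the left side lies in the ideal. This is the recursion behind
`IsAreaIdeal.curl_mul_mem`; the coefficient 2 is why E + 2 appears there. -/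
theorem area_area_letter {f : ShuffleSeries K} (hf : f ∈ areaSubmodule K) (u : ShuffleSeries K)
    (t : Bool) :
    area (curl u) (area (letter t) f) - area (letter t) (area (curl u) f) =
      curl (f * (letter t * u + (2 : K) • app t u) - area (letter t) f * u) := by
  have hm : area (curl u) (area (letter t) f) - area (letter t) (area (curl u) f) ∈
      areaSubmodule K :=
    sub_mem (area_mem (curl_mem u) (area_mem (letter_mem t) hf))
      (area_mem (letter_mem t) (area_mem (curl_mem u) hf))
  rw [eq_curl_of_aug_der hm]
  · congr 1
    cases t <;> simp [two_smul] <;> ring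
  · intro s
    cases s <;> cases t <;> simp

theorem area_area_letters {f : ShuffleSeries K} (hf : f ∈ areaSubmodule K) :
    area (letter true) (area (letter false) f) - area (letter false) (area (letter true) f) =
      -(2 : K) • curl f := by
  have hm : area (letter true) (area (letter false) f) -
      area (letter false) (area (letter true) f) ∈ areaSubmodule K :=
    sub_mem (area_mem (letter_mem _) (area_mem (letter_mem _) hf))
      (area_mem (letter_mem _) (area_mem (letter_mem _) hf))
  rw [eq_curl_of_aug_der hm, ← map_smul]
  · congr 1
    simp [two_smul]
    ring
  · intro s
    cases s <;> simp [hf.1]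

end ShuffleSeries

/-! ### The area subalgebra generates the shuffle algebra. -/

namespace ShuffleSeries

variable {K : Type u} [Field K]

theorem half_mul_right (a b c : ShuffleSeries K) :
    half a (b * c) = half (a * b) c + half (a * c) b := by
  apply ext_der
  · simp
  · intro t; simp; ring

theorem half_area_right (a b c : ShuffleSeries K) :
    half a (area b c) = half (a * b) c - half (a * c) b := by
  apply ext_der
  · simp
  · intro t; simp; ring

theorem half_letter_right (a : ShuffleSeries K) (t : Bool) : half a (letter t) = app t a := by
  apply ext_der
  · simp
  · intro s; cases s <;> cases t <;> simp

/-- `AreaMonomial k n c` says that `c` is a product of `k` elements of `areaSubmodule K` whose degrees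
are bounded by integers with sum `n`. -/
inductive AreaMonomial : ℕ → ℤ → ShuffleSeries K → Prop
  | one : AreaMonomial 0 0 1
  | mul {k : ℕ} {m n : ℤ} {l c : ShuffleSeries K} (hl : l ∈ areaSubmodule K)
      (hm : l ∈ degLE K m) (hc : AreaMonomial k n c) : AreaMonomial (k + 1) (m + n) (l * c)

theorem AreaMonomial.mul_mul {i j : ℕ} {m n : ℤ} {b c : ShuffleSeries K} (hb : AreaMonomial i m b)
    (hc : AreaMonomial j n c) : AreaMonomial (i + j) (m + n) (b * c) := by
  induction hb with
  | one => simpa using hc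
  | mul hl hm _ ih =>
    convert AreaMonomial.mul hl hm ih using 1 <;> ring

/-- The span of the area monomials of degree at most `n`. -/
def areaSpan (K : Type u) [Field K] (n : ℤ) : Submodule K (ShuffleSeries K) :=
  Submodule.span K {c | ∃ k : ℕ, ∃ m ≤ n, AreaMonomial k m c}

theorem AreaMonomial.mem {k : ℕ} {n : ℤ} {c : ShuffleSeries K} (hc : AreaMonomial k n c) :
    c ∈ areaSpan K n :=
  Submodule.subset_span ⟨k, n, le_rfl, hc⟩

theorem areaSpan_mono {m n : ℤ} (h : m ≤ n) : areaSpan K m ≤ areaSpan K n :=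
  Submodule.span_mono fun _ ⟨k, j, hj, hc⟩ => ⟨k, j, hj.trans h, hc⟩

/-- Modulo products of area elements, the factor l can be exchanged with each of the i factors of c
in turn. The Leibniz rule `half_mul_right` singles out one factor m of c, and the error of the
exchange is a half-shuffle of fewer factors with `area l m`, covered by `H`. -/
theorem half_sub_smul_half_mem {k : ℕ}
    (H : ∀ j < k, ∀ {a b : ℤ} {c l : ShuffleSeries K}, AreaMonomial j a c → l ∈ areaSubmodule K →
      l ∈ degLE K b → half c l ∈ areaSpan K (a + b))
    {i j : ℕ} (hk : i + j = k) {a b d : ℤ} {e c l : ShuffleSeries K} (he : AreaMonomial j a e)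
    (hc : AreaMonomial i b c) (hl : l ∈ areaSubmodule K) (hd : l ∈ degLE K d) :
    half (e * l) c - (i : K) • half (e * c) l ∈ areaSpan K (a + b + d) := by
  induction hc generalizing j a e with
  | one =>
    have : half (e * l) 1 = 0 := by simp [half_def]
    simp [this]
  | @mul i b₁ b₂ m c hm hb₁ hc ih =>
    have h1 := ih (j := j + 1) (by omega) (AreaMonomial.mul hm hb₁ he)
    have h2 := H (i + j) (by omega) (add_comm j i ▸ he.mul_mul hc) (area_mem hl hm)
      (area_mem_degLE hd hb₁)
    rw [half_area_right] at h2
    rw [half_mul_right]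
    have h3 := add_mem h1 (show b₁ + a + b₂ + d = a + b₂ + (d + b₁) by ring ▸ h2)
    rw [show b₁ + a + b₂ + d = a + (b₁ + b₂) + d by ring] at h3
    convert h3 using 1
    rw [show m * e * l = e * l * m by ring, show m * e * c = e * (m * c) by ring,
      show e * c * l = e * l * c by ring, show e * c * m = e * (m * c) by ring]
    push_cast
    module

variable [CharZero K]

/-- Modulo the span, l ∘ c is k (c ∘ l) by the exchange lemma with e = 1, while l ∘ c + c ∘ l = l c
is in the span. Hence (k + 1)(c ∘ l) is in the span. -/
theorem half_mem_areaSpan (k : ℕ) : ∀ {a b : ℤ} {c l : ShuffleSeries K}, AreaMonomial k a c →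
    l ∈ areaSubmodule K → l ∈ degLE K b → half c l ∈ areaSpan K (a + b) := by
  induction k using Nat.strong_induction_on with
  | _ k ih =>
  intro a b c l hc hl hb
  have h1 := half_sub_smul_half_mem ih (add_zero k) .one hc hl hb
  rw [one_mul, one_mul, zero_add] at h1
  have h2 := (AreaMonomial.mul hl hb hc).mem
  rw [mul_comm, ← half_add_half_swap (by simp [hl.1]), add_comm b a] at h2
  have h3 := sub_mem h2 h1
  have h0 : ((k + 1 : ℕ) : K) ≠ 0 := by exact_mod_cast k.succ_ne_zero
  rw [← Submodule.smul_mem_iff _ h0]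
  convert h3 using 1
  push_cast
  module

theorem app_mem_areaSpan (t : Bool) {n : ℤ} {p : ShuffleSeries K} (hp : p ∈ areaSpan K n) :
    app t p ∈ areaSpan K (n + 1) := by
  induction hp using Submodule.span_induction with
  | mem p hp =>
    obtain ⟨k, m, hm, hp⟩ := hp
    rw [← half_letter_right]
    exact areaSpan_mono (by omega)
      (half_mem_areaSpan k hp (letter_mem t) (letter_mem_degLE t))
  | zero => simp
  | add p q _ _ hp hq => rw [map_add]; exact add_mem hp hq
  | smul c p _ hp => rw [map_smul]; exact Submodule.smul_mem _ _ hp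

/-- The shuffle algebra is generated by `areaSubmodule K`, compatibly with degrees. -/
theorem degLE_le_areaSpan (n : ℤ) : degLE K n ≤ areaSpan K n := by
  intro z hz
  rcases lt_or_ge n 0 with hn | hn
  · rw [eq_zero_of_mem_degLE_neg hn hz]; exact zero_mem _
  lift n to ℕ using hn
  have hc : ∀ c : K, ∀ n : ℕ, algebraMap K _ c ∈ areaSpan K n := fun c n => by
    rw [Algebra.algebraMap_eq_smul_one]
    exact Submodule.smul_mem _ _ (areaSpan_mono (by omega) AreaMonomial.one.mem)
  induction n generalizing z with
  | zero => rw [eq_algebraMap_of_mem_degLE_zero hz]; exact hc _ 0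
  | succ n ih =>
    have h : ∀ t, app t (der t z) ∈ areaSpan K (n + 1 : ℕ) := fun t => by
      have := der_mem_degLE t hz
      push_cast at this ⊢
      rw [add_sub_cancel_right] at this
      exact app_mem_areaSpan t (ih this)
    rw [eq_sum_app z]
    exact add_mem (add_mem (hc _ _) (h true)) (h false)

/-- An induction principle for the shuffle algebra. -/
theorem mem_of_mem_degLE (G : ℤ → Submodule K (ShuffleSeries K)) (hG : Monotone G)
    (h1 : 1 ∈ G 0) (hmul : ∀ a b l z, l ∈ areaSubmodule K → l ∈ degLE K a → z ∈ G b →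
      l * z ∈ G (a + b)) {n : ℤ} {z : ShuffleSeries K} (hz : z ∈ degLE K n) : z ∈ G n := by
  refine Submodule.span_le.2 ?_ (degLE_le_areaSpan n hz)
  rintro c ⟨k, m, hm, hc⟩
  refine hG hm ?_
  clear hz hm
  induction hc with
  | one => exact h1
  | mul hl hm _ ih => exact hmul _ _ _ _ hl hm ih

end ShuffleSeries

/-! ### Area ideals and the shuffle ideals they generate. -/

namespace ShuffleSeries

variable {K : Type u} [Field K]

/-- `I` is an ideal of the algebra of polynomials in `areaSubmodule K` under `area`. -/
structure IsAreaIdeal (I : Submodule K (ShuffleSeries K)) : Prop where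
  le : I ≤ areaSubmodule K
  area_mem : ∀ {n : ℤ} {l f : ShuffleSeries K}, l ∈ areaSubmodule K → l ∈ degLE K n → f ∈ I →
    area l f ∈ I

/-- The part of degree at most `n` of the shuffle ideal generated by `I`. -/
def shuffleIdeal (I : Submodule K (ShuffleSeries K)) (n : ℤ) : Submodule K (ShuffleSeries K) :=
  Submodule.span K {p | ∃ a b : ℤ, ∃ z f, a + b ≤ n ∧ z ∈ degLE K a ∧ f ∈ I ∧ f ∈ degLE K b ∧
    z * f = p}

section

variable {I : Submodule K (ShuffleSeries K)}

theorem mul_mem_shuffleIdeal {a b n : ℤ} {z f : ShuffleSeries K} (hz : z ∈ degLE K a) (hf : f ∈ I)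
    (hb : f ∈ degLE K b) (h : a + b ≤ n) : z * f ∈ shuffleIdeal I n :=
  Submodule.subset_span ⟨a, b, z, f, h, hz, hf, hb, rfl⟩

theorem mem_shuffleIdeal {n : ℤ} {f : ShuffleSeries K} (hf : f ∈ I) (hn : f ∈ degLE K n) :
    f ∈ shuffleIdeal I n := by
  simpa using mul_mem_shuffleIdeal one_mem_degLE hf hn (zero_add n).le

theorem shuffleIdeal_mono {m n : ℤ} (h : m ≤ n) : shuffleIdeal I m ≤ shuffleIdeal I n :=
  Submodule.span_mono fun _ ⟨a, b, z, f, hab, hr⟩ => ⟨a, b, z, f, hab.trans h, hr⟩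

theorem shuffleIdeal_le_degLE (n : ℤ) : shuffleIdeal I n ≤ degLE K n :=
  Submodule.span_le.2 fun _ ⟨_, _, _, _, hab, hz, _, hf, e⟩ =>
    e ▸ degLE_mono hab (mul_mem_degLE hz hf)

theorem mul_shuffleIdeal {m n : ℤ} {w p : ShuffleSeries K} (hw : w ∈ degLE K m)
    (hp : p ∈ shuffleIdeal I n) : w * p ∈ shuffleIdeal I (m + n) := by
  induction hp using Submodule.span_induction with
  | mem p hp =>
    obtain ⟨a, b, z, f, hab, hz, hf, hb, rfl⟩ := hp
    rw [← mul_assoc]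
    exact mul_mem_shuffleIdeal (mul_mem_degLE hw hz) hf hb (by omega)
  | zero => simp
  | add p q _ _ hp hq => rw [mul_add]; exact add_mem hp hq
  | smul c p _ hp => rw [mul_smul_comm]; exact Submodule.smul_mem _ _ hp

end

variable {I : Submodule K (ShuffleSeries K)} (hI : IsAreaIdeal I)

include hI

theorem IsAreaIdeal.aug_eq_zero {n : ℤ} {p : ShuffleSeries K} (hp : p ∈ shuffleIdeal I n) :
    aug p = 0 := by
  induction hp using Submodule.span_induction with
  | mem p hp =>
    obtain ⟨a, b, z, f, -, -, hf, -, rfl⟩ := hp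
    rw [aug_mul, (hI.le hf).1, mul_zero]
  | zero => simp
  | add p q _ _ hp hq => rw [map_add, hp, hq, add_zero]
  | smul c p _ hp => rw [map_smul, hp, smul_zero]

theorem IsAreaIdeal.eq_zero_of_nonpos {n : ℤ} (hn : n ≤ 0) {p : ShuffleSeries K}
    (hp : p ∈ shuffleIdeal I n) : p = 0 := by
  rw [eq_algebraMap_of_mem_degLE_zero (degLE_mono hn (shuffleIdeal_le_degLE n hp)),
    hI.aug_eq_zero hp, map_zero]

variable [CharZero K]

/-- With g = [f, t] in I, one has f ∘ (t u + ut) = u g - g ∘ u + u t f, where ut denotes u with the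
letter t appended. Only g ∘ u is not visibly in the ideal, and u has smaller degree than the
original second argument. Invertibility of E + 1 puts every W, up to a constant, in the form of a
sum of such t u + ut. -/
theorem IsAreaIdeal.half_mem (m : ℕ) : ∀ {b : ℤ} {W f : ShuffleSeries K}, W ∈ degLE K m → f ∈ I →
    f ∈ degLE K b → half f W ∈ shuffleIdeal I (m + b) := by
  induction m with
  | zero =>
    intro b W f hW hf hb
    rw [eq_algebraMap_of_mem_degLE_zero hW, half_def]
    simp
  | succ m ih =>
    intro b W f hW hf hb
    obtain ⟨W, hW', rfl⟩ := exists_euler_add_smul 0 hW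
    have key : ∀ t, half f (letter t * der t W + app t (der t W)) ∈
        shuffleIdeal I ((m + 1 : ℕ) + b) := by
      intro t
      have hu : der t W ∈ degLE K m := by
        have := der_mem_degLE t hW'
        push_cast at this
        rwa [add_sub_cancel_right] at this
      generalize der t W = u at hu
      have hft : area f (letter t) ∈ I := by
        have := neg_mem (hI.area_mem (letter_mem t) (letter_mem_degLE t) hf)
        rwa [area_def, neg_sub, ← area_def] at this
      have hftb : area f (letter t) ∈ degLE K (b + 1) := area_mem_degLE hb (letter_mem_degLE t)
      have h1 := ih hu hft hftb
      have h2 := mul_mem_shuffleIdeal (n := (m + 1 : ℕ) + b) hu hft hftb (by push_cast; omega)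
      have h3 := mul_mem_shuffleIdeal (n := (m + 1 : ℕ) + b)
        (mul_mem_degLE hu (letter_mem_degLE t)) hf hb (by push_cast; omega)
      rw [show (m : ℤ) + (b + 1) = (m + 1 : ℕ) + b by push_cast; ring] at h1
      convert add_mem (sub_mem h2 h1) h3 using 1
      apply ext_der
      · simp [(hI.le hf).1]
      · intro s
        cases s <;> cases t <;> simp <;> ring
    have e : half f (euler W + ((0 + 1 : ℕ) : K) • W) =
        half f (letter true * der true W + app true (der true W)) +
        half f (letter false * der false W + app false (der false W)) := by
      apply ext_der
      · simp
      · intro s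
        cases s <;> simp [euler_def] <;> ring
    rw [e]
    exact add_mem (key true) (key false)

theorem IsAreaIdeal.app_mem (t : Bool) {n : ℤ} {p : ShuffleSeries K} (hp : p ∈ shuffleIdeal I n) :
    app t p ∈ shuffleIdeal I (n + 1) := by
  induction hp using Submodule.span_induction with
  | mem p hp =>
    obtain ⟨a, b, z, f, hab, hz, hf, hb, rfl⟩ := hp
    -- Both sides have f z as their only nonzero derivative, so appending a letter to a multiple of
    -- f is a half-shuffle with left factor f.
    have e : app t (z * f) = half f (app t z) := by
      apply ext_der
      · simp
      · intro s; cases s <;> cases t <;> simp [mul_comm]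
    rw [e]
    rcases lt_or_ge a 0 with ha | ha
    · rw [eq_zero_of_mem_degLE_neg ha hz, map_zero, map_zero]; exact zero_mem _
    · lift a to ℕ using ha
      have := hI.half_mem (a + 1) (W := app t z) (app_mem_degLE t hz) hf hb
      exact shuffleIdeal_mono (by push_cast; omega) this
  | zero => simp
  | add p q _ _ hp hq => rw [map_add]; exact add_mem hp hq
  | smul c p _ hp => rw [map_smul]; exact Submodule.smul_mem _ _ hp

/-- Induction on the degree of z: `area_area_letters` gives constant z, and `area_area_letter`
reduces `curl` of f (t u + 2 ut) to the product of u with [t, f], which is again in I. Invertibility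
of E + 2 shows that these cases suffice. -/
theorem IsAreaIdeal.curl_mul_mem (m : ℕ) : ∀ {z f : ShuffleSeries K}, z ∈ degLE K m → f ∈ I →
    curl (z * f) ∈ I := by
  have hcurl : ∀ {f}, f ∈ I → curl f ∈ I := fun {f} hf => by
    have hl : ∀ s t, area (letter s) (area (letter t) f) ∈ I := fun s t =>
      hI.area_mem (letter_mem s) (letter_mem_degLE s)
        (hI.area_mem (letter_mem t) (letter_mem_degLE t) hf)
    have := sub_mem (hl true false) (hl false true)
    rw [area_area_letters (hI.le hf)] at this
    exact (Submodule.smul_mem_iff _ (neg_ne_zero.2 two_ne_zero)).1 this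
  have hconst : ∀ (c : K) {f}, f ∈ I → curl (algebraMap K _ c * f) ∈ I := fun c f hf => by
    rw [← Algebra.smul_def, map_smul]
    exact Submodule.smul_mem _ _ (hcurl hf)
  induction m with
  | zero =>
    intro z f hz hf
    rw [eq_algebraMap_of_mem_degLE_zero hz]
    exact hconst _ hf
  | succ m ih =>
    intro z f hz hf
    obtain ⟨z, hz', rfl⟩ := exists_euler_add_smul 1 hz
    have key : ∀ t, curl (f * (letter t * der t z + (2 : K) • app t (der t z))) ∈ I := by
      intro t
      have hu : der t z ∈ degLE K m := by
        have := der_mem_degLE t hz'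
        push_cast at this
        rwa [add_sub_cancel_right] at this
      generalize der t z = u at hu
      have h1 := hI.area_mem (letter_mem t) (letter_mem_degLE t) hf
      have h2 := area_area_letter (hI.le hf) u t
      rw [map_sub, mul_comm (area (letter t) f) u, eq_sub_iff_add_eq] at h2
      rw [← h2]
      exact add_mem (sub_mem (hI.area_mem (curl_mem u) (curl_mem_degLE hu) h1)
        (hI.area_mem (letter_mem t) (letter_mem_degLE t)
          (hI.area_mem (curl_mem u) (curl_mem_degLE hu) hf))) (ih hu h1)
    have e : (euler z + ((1 + 1 : ℕ) : K) • z) * f = algebraMap K _ (2 * aug z) * f +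
        f * (letter true * der true z + (2 : K) • app true (der true z)) +
        f * (letter false * der false z + (2 : K) • app false (der false z)) := by
      simp only [Algebra.smul_def, map_mul, map_natCast, map_ofNat, euler_def]
      push_cast
      linear_combination 2 * f * eq_sum_app z
    rw [e, map_add, map_add]
    exact add_mem (add_mem (hconst _ hf) (key true)) (key false)

theorem IsAreaIdeal.curl_mem {n : ℤ} {p : ShuffleSeries K} (hp : p ∈ shuffleIdeal I n) :
    curl p ∈ I := by
  induction hp using Submodule.span_induction with
  | mem p hp =>
    obtain ⟨a, b, z, f, -, hz, hf, -, rfl⟩ := hp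
    exact hI.curl_mul_mem a.toNat (degLE_mono (Int.self_le_toNat a) hz) hf
  | zero => simp
  | add p q _ _ hp hq => rw [map_add]; exact add_mem hp hq
  | smul c p _ hp => rw [map_smul]; exact Submodule.smul_mem _ _ hp

end ShuffleSeries

/-! ### The shuffle ideal meets the area subalgebra in the area ideal. -/

namespace ShuffleSeries

variable {K : Type u} [Field K]

/-- The elements of the shuffle ideal whose derivatives are in the shuffle ideal, too. -/
def derClosed (I : Submodule K (ShuffleSeries K)) (n : ℤ) : Submodule K (ShuffleSeries K) :=
  shuffleIdeal I n ⊓ ⨅ t, (shuffleIdeal I (n - 1)).comap (der t)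

theorem mem_derClosed {I : Submodule K (ShuffleSeries K)} {n : ℤ} {q : ShuffleSeries K} :
    q ∈ derClosed I n ↔ q ∈ shuffleIdeal I n ∧ ∀ t, der t q ∈ shuffleIdeal I (n - 1) := by
  simp [derClosed]

theorem derClosed_mono {I : Submodule K (ShuffleSeries K)} {m n : ℤ} (h : m ≤ n) :
    derClosed I m ≤ derClosed I n := fun q hq => by
  rw [mem_derClosed] at hq ⊢
  exact ⟨shuffleIdeal_mono h hq.1, fun t => shuffleIdeal_mono (by omega) (hq.2 t)⟩

theorem mul_derClosed {I : Submodule K (ShuffleSeries K)} {m n : ℤ} {w q : ShuffleSeries K}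
    (hw : w ∈ degLE K m) (hq : q ∈ derClosed I n) : w * q ∈ derClosed I (m + n) := by
  rw [mem_derClosed] at hq ⊢
  refine ⟨mul_shuffleIdeal hw hq.1, fun t => ?_⟩
  have h1 := mul_shuffleIdeal (der_mem_degLE t hw) hq.1
  have h2 := mul_shuffleIdeal hw (hq.2 t)
  rw [show m - 1 + n = m + n - 1 by ring] at h1
  rw [show m + (n - 1) = m + n - 1 by ring] at h2
  rw [der_mul]
  exact add_mem h1 h2

/-- The series `z` of degree at most `n` that multiply `I` to `I` up to `derClosed I`. -/
def multipliers (I : Submodule K (ShuffleSeries K)) (n : ℤ) : Submodule K (ShuffleSeries K) where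
  carrier := {z | z ∈ degLE K n ∧ ∀ b : ℤ, ∀ f ∈ I, f ∈ degLE K b →
    z * f ∈ I ⊓ degLE K (n + b) ⊔ derClosed I (n + b)}
  add_mem' hz hw := ⟨add_mem hz.1 hw.1, fun b f hf hb => by
    rw [add_mul]; exact add_mem (hz.2 b f hf hb) (hw.2 b f hf hb)⟩
  zero_mem' := ⟨zero_mem _, fun b f hf hb => by rw [zero_mul]; exact zero_mem _⟩
  smul_mem' c z hz := ⟨Submodule.smul_mem _ _ hz.1, fun b f hf hb => by
    rw [smul_mul_assoc]; exact Submodule.smul_mem _ _ (hz.2 b f hf hb)⟩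

variable [CharZero K] {I : Submodule K (ShuffleSeries K)} (hI : IsAreaIdeal I)

include hI

/-- Induction on products of area elements, using l f = [l, f] + 2 f ∘ l. Here [l, f] is in I, and f
∘ l has derivatives f ∂ₜl, so it lies in `derClosed I`, which is stable under shuffle
multiplication. -/
theorem IsAreaIdeal.degLE_le_multipliers (n : ℤ) : degLE K n ≤ multipliers I n := by
  intro z hz
  refine mem_of_mem_degLE (multipliers I) ?_ ?_ ?_ hz
  · exact fun m n hmn z hz => ⟨degLE_mono hmn hz.1, fun b f hf hb =>
      sup_le_sup (inf_le_inf_left _ (degLE_mono (by omega))) (derClosed_mono (by omega))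
        (hz.2 b f hf hb)⟩
  · refine ⟨one_mem_degLE, fun b f hf hb => Submodule.mem_sup_left ?_⟩
    rw [one_mul, zero_add]
    exact ⟨hf, hb⟩
  · intro a b l z hl ha hz
    refine ⟨mul_mem_degLE ha hz.1, fun c f hf hc => ?_⟩
    have e : l * z * f = z * area l f + (2 : K) • (z * half f l) := by
      rw [area_def, two_smul]
      linear_combination (-z) * half_add_half_swap (a := l) (b := f) (by simp [hl.1])
    have h1 := hz.2 (a + c) _ (hI.area_mem hl ha hf) (area_mem_degLE ha hc)
    have hq : half f l ∈ derClosed I (a + c) := by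
      rw [mem_derClosed]
      constructor
      · rcases lt_or_ge a 0 with h | h
        · rw [eq_zero_of_mem_degLE_neg h ha, map_zero]; exact zero_mem _
        · lift a to ℕ using h
          exact hI.half_mem a ha hf hc
      · intro t
        rw [der_half, mul_comm]
        exact mul_mem_shuffleIdeal (der_mem_degLE t ha) hf hc (by omega)
    have h2 := Submodule.mem_sup_right (S := I ⊓ degLE K (b + (a + c))) (mul_derClosed hz.1 hq)
    rw [e, show a + b + c = b + (a + c) by ring]
    exact add_mem h1 (Submodule.smul_mem _ _ h2)

theorem IsAreaIdeal.exists_add_of_mem {n : ℤ} {p : ShuffleSeries K} (hp : p ∈ shuffleIdeal I n) :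
    ∃ i ∈ I, i ∈ degLE K n ∧ ∃ q ∈ derClosed I n, i + q = p := by
  suffices h : shuffleIdeal I n ≤ I ⊓ degLE K n ⊔ derClosed I n by
    obtain ⟨i, hi, q, hq, e⟩ := Submodule.mem_sup.1 (h hp)
    exact ⟨i, hi.1, hi.2, q, hq, e⟩
  refine Submodule.span_le.2 ?_
  rintro _ ⟨a, b, z, f, hab, hz, hf, hb, rfl⟩
  exact sup_le_sup (inf_le_inf_left _ (degLE_mono hab)) (derClosed_mono hab)
    ((hI.degLE_le_multipliers a hz).2 b f hf hb)

variable (hx : letter true ∉ I)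

include hx

/-- Induction on degree. Write rx = i + q with i in I and q in `derClosed I`. Applying ∂ᵧ shows that
∂ᵧi is in the shuffle ideal; it ends in x, so by induction i = αx + `curl v` with v in the ideal.
Then αx is in I, so α = 0, and r = ∂ₓi + ∂ₓq = -vy + ∂ₓq is in the ideal. -/
theorem IsAreaIdeal.mem_of_app_mem (k : ℕ) : ∀ {n : ℤ}, n ≤ k → ∀ {r : ShuffleSeries K},
    app true r ∈ shuffleIdeal I n → r ∈ shuffleIdeal I (n - 1) := by
  have base : ∀ {n : ℤ}, n ≤ 0 → ∀ {r : ShuffleSeries K},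
      app true r ∈ shuffleIdeal I n → r ∈ shuffleIdeal I (n - 1) := fun hn r hr => by
    have h := congrArg (der true) (hI.eq_zero_of_nonpos hn hr)
    rw [der_app_self, map_zero] at h
    rw [h]; exact zero_mem _
  induction k with
  | zero => exact fun hn => base (by simpa using hn)
  | succ k ih =>
    intro n hn r hr
    obtain ⟨i, hi, -, q, hq, e⟩ := hI.exists_add_of_mem hr
    rw [mem_derClosed] at hq
    have hiL := hI.le hi
    have e1 := congrArg (der true) e
    have e2 := congrArg (der false) e
    rw [map_add, der_app_self] at e1
    rw [map_add, der_false_app_true] at e2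
    have h2 : der false i ∈ shuffleIdeal I (n - 1) := by
      rw [eq_neg_of_add_eq_zero_left e2]; exact neg_mem (hq.2 false)
    have h2' := der_false_eq hiL
    have h0 := hI.aug_eq_zero h2
    rw [h0, map_zero, zero_add] at h2'
    rw [h2'] at h2
    have h3 : der true (der false i) ∈ shuffleIdeal I (n - 1 - 1) :=
      ih (by push_cast at hn; omega) h2
    have h4 := eq_curl_of_mem hiL
    rw [h0, zero_smul, add_zero] at h4
    have h5 : aug (der true i) • letter true ∈ I := by
      rw [eq_sub_of_add_eq h4.symm]
      exact sub_mem hi (hI.curl_mem h3)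
    have h6 : aug (der true i) = 0 := by
      by_contra h
      exact hx ((Submodule.smul_mem_iff _ h).1 h5)
    have h7 := der_true_eq hiL
    rw [h6, map_zero, zero_sub] at h7
    rw [← e1, h7]
    have h8 := hI.app_mem false h3
    rw [sub_add_cancel] at h8
    exact add_mem (neg_mem h8) (hq.2 true)

/-- After subtracting an element of I, what remains is q = `curl u` whose derivative ∂ᵧq = ux lies
in the shuffle ideal. Cancelling x puts u in the ideal, and `curl` sends it into I. -/
theorem IsAreaIdeal.mem_of_mem_shuffleIdeal {n : ℤ} {p : ShuffleSeries K}
    (hp : p ∈ shuffleIdeal I n) (hL : p ∈ areaSubmodule K) : p ∈ I := by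
  obtain ⟨i, hi, -, q, hq, rfl⟩ := hI.exists_add_of_mem hp
  rw [mem_derClosed] at hq
  have hqL : q ∈ areaSubmodule K := by simpa using sub_mem hL (hI.le hi)
  have h0 : ∀ t, aug (der t q) = 0 := fun t => hI.aug_eq_zero (hq.2 t)
  have h1 := hq.2 false
  rw [der_false_eq hqL, h0, map_zero, zero_add] at h1
  refine add_mem hi ?_
  rw [eq_curl_of_aug_der hqL h0]
  exact hI.curl_mem (hI.mem_of_app_mem hx n.toNat (by omega) h1)

end ShuffleSeries

/-! ### Quotients by two-sided ideals and a criterion for speciality. -/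

section QuotientMul

variable {K A : Type*} [Field K] [NonUnitalNonAssocRing A] [Module K A] [IsScalarTower K A A]
  [SMulCommClass K A A]

/-- The product on the quotient of an algebra by a two-sided ideal. -/
def quotientMul (N : Submodule K A) (hl : ∀ a, ∀ n ∈ N, a * n ∈ N) (hr : ∀ n ∈ N, ∀ a, n * a ∈ N) :
    (A ⧸ N) →ₗ[K] (A ⧸ N) →ₗ[K] (A ⧸ N) :=
  N.liftQ (N.liftQ ((LinearMap.mul K A).compr₂ N.mkQ).flip fun n hn => by
    ext a; exact (Submodule.Quotient.mk_eq_zero N).2 (hl a n hn)).flip fun n hn => by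
    ext a; exact (Submodule.Quotient.mk_eq_zero N).2 (hr n hn a)

/-- The quotient of an algebra by a two-sided ideal, as a nonassociative ring. -/
abbrev quotientRing (N : Submodule K A) (hl : ∀ a, ∀ n ∈ N, a * n ∈ N)
    (hr : ∀ n ∈ N, ∀ a, n * a ∈ N) : NonUnitalNonAssocRing (A ⧸ N) :=
  { (inferInstance : AddCommGroup (A ⧸ N)) with
    mul := fun x y => quotientMul N hl hr x y
    left_distrib := fun x y z => (quotientMul N hl hr x).map_add y z
    right_distrib := fun x y z => (quotientMul N hl hr).map_add₂ x y z
    zero_mul := fun x => (quotientMul N hl hr).map_zero₂ x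
    mul_zero := fun x => (quotientMul N hl hr x).map_zero }

end QuotientMul

theorem IsTortkara.prod {P Q : Type*} [NonUnitalNonAssocRing P] [NonUnitalNonAssocRing Q]
    (hP : IsTortkara P) (hQ : IsTortkara Q) : IsTortkara (P × Q) where
  anticomm _ _ := Prod.ext (hP.anticomm _ _) (hQ.anticomm _ _)
  tortkara _ _ _ := Prod.ext (hP.tortkara _ _ _) (hQ.tortkara _ _ _)

/-- A criterion for speciality: `W` is the graph of a homomorphism from a subset of `A⁽⁻⁾` onto `B`
whose kernel is cut out by a two-sided ideal of `A`. -/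
theorem isSpecial_of_graph {K : Type u} {A : Type u} {B : Type v} [Field K]
    [NonUnitalNonAssocRing A] [Module K A] [IsScalarTower K A A] [SMulCommClass K A A]
    [NonUnitalNonAssocRing B] [Module K B] (hA : IsZinbiel A) (W : Submodule K (MinusAlgebra A × B))
    (hW : ∀ p ∈ W, ∀ q ∈ W, p * q ∈ W) (hsurj : ∀ b, ∃ p ∈ W, p.2 = b) (N : Submodule K A)
    (hl : ∀ a, ∀ n ∈ N, a * n ∈ N) (hr : ∀ n ∈ N, ∀ a, n * a ∈ N)
    (hN : ∀ p ∈ W, MinusAlgebra.of.symm p.1 ∈ N ↔ p.2 = 0) : IsSpecial K B := by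
  let := quotientRing N hl hr
  have : IsScalarTower K (A ⧸ N) (A ⧸ N) :=
    ⟨fun c x y => (quotientMul N hl hr).map_smul₂ c x y⟩
  have : SMulCommClass K (A ⧸ N) (A ⧸ N) :=
    ⟨fun c x y => ((quotientMul N hl hr x).map_smul c y).symm⟩
  choose r hrW hr2 using hsurj
  have hiff : ∀ p ∈ W, ∀ q ∈ W, N.mkQ (MinusAlgebra.of.symm p.1) =
      N.mkQ (MinusAlgebra.of.symm q.1) ↔ p.2 = q.2 := fun p hp q hq => by
    rw [← sub_eq_zero (a := p.2), ← Prod.snd_sub, ← hN _ (sub_mem hp hq)]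
    exact Submodule.Quotient.eq N
  refine ⟨ULift.{v} (A ⧸ N), inferInstance, inferInstance, inferInstance,
    ⟨fun c x y => congrArg ULift.up (smul_comm c x.down y.down)⟩, ?_, ?_⟩
  · rintro ⟨a⟩ ⟨b⟩ ⟨c⟩
    obtain ⟨a, rfl⟩ := N.mkQ_surjective a
    obtain ⟨b, rfl⟩ := N.mkQ_surjective b
    obtain ⟨c, rfl⟩ := N.mkQ_surjective c
    exact congrArg (fun x => ULift.up (N.mkQ x)) (hA a b c)
  · refine ⟨{ toFun := fun b => MinusAlgebra.of (ULift.up (N.mkQ (MinusAlgebra.of.symm (r b).1)))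
              map_smul' := ?_
              map_zero' := ?_
              map_add' := ?_
              map_mul' := ?_ }, ?_⟩
    · exact fun c b => congrArg (fun x => MinusAlgebra.of (ULift.up x))
        ((hiff _ (hrW _) (c • r b) (W.smul_mem _ (hrW _))).2 (by simp [hr2]))
    · exact congrArg (fun x => MinusAlgebra.of (ULift.up x))
        ((hiff _ (hrW _) 0 W.zero_mem).2 (by simp [hr2]))
    · exact fun b c => congrArg (fun x => MinusAlgebra.of (ULift.up x))
        ((hiff _ (hrW _) (r b + r c) (W.add_mem (hrW _) (hrW _))).2 (by simp [hr2]))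
    · exact fun b c => congrArg (fun x => MinusAlgebra.of (ULift.up x))
        ((hiff _ (hrW _) (r b * r c) (hW _ (hrW _) _ (hrW _))).2 (by simp [hr2]))
    · intro b c h
      have h' := congrArg (fun x => (MinusAlgebra.of.symm x).down) h
      rw [← hr2 b, ← hr2 c]
      exact (hiff _ (hrW _) _ (hrW _)).1 h'

/-! ### The free Zinbiel algebra and the Tortkara identity in its minus-algebra. -/

namespace ShuffleSeries

variable (K : Type u) [Field K]

/-- The polynomials without constant term. -/
def posSubmodule : Submodule K (ShuffleSeries K) where
  carrier := {f | aug f = 0 ∧ ∃ n : ℤ, f ∈ degLE K n}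
  add_mem' := fun ⟨hf, m, hm⟩ ⟨hg, n, hn⟩ => ⟨by simp [hf, hg], max m n,
    add_mem (degLE_mono (le_max_left _ _) hm) (degLE_mono (le_max_right _ _) hn)⟩
  zero_mem' := ⟨map_zero _, 0, zero_mem _⟩
  smul_mem' c f := fun ⟨hf, n, hn⟩ => ⟨by simp [hf], n, Submodule.smul_mem _ _ hn⟩

end ShuffleSeries

open ShuffleSeries

/-- The free Zinbiel algebra on two letters. -/
def FreeZinbiel (K : Type u) [Field K] : Type u := posSubmodule K

namespace FreeZinbiel

variable {K : Type u} [Field K]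

instance : AddCommGroup (FreeZinbiel K) := inferInstanceAs (AddCommGroup (posSubmodule K))
instance : Module K (FreeZinbiel K) := inferInstanceAs (Module K (posSubmodule K))

/-- The inclusion into the space of series. -/
def toSeries : FreeZinbiel K →ₗ[K] ShuffleSeries K := (posSubmodule K).subtype

theorem toSeries_injective : Function.Injective (toSeries : FreeZinbiel K → ShuffleSeries K) :=
  Subtype.val_injective

theorem aug_toSeries (a : FreeZinbiel K) : aug (toSeries a) = 0 := a.2.1

instance : Mul (FreeZinbiel K) where
  mul a b := ⟨half (toSeries a) (toSeries b), aug_half _ _, by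
    obtain ⟨⟨m, hm⟩, n, hn⟩ := And.intro a.2.2 b.2.2
    exact ⟨m + n, half_mem_degLE hm hn⟩⟩

theorem toSeries_mul (a b : FreeZinbiel K) : toSeries (a * b) = half (toSeries a) (toSeries b) :=
  rfl

instance : NonUnitalNonAssocRing (FreeZinbiel K) :=
  { (inferInstance : AddCommGroup (FreeZinbiel K)) with
    left_distrib := fun _ _ _ => toSeries_injective (by simp [toSeries_mul])
    right_distrib := fun _ _ _ => toSeries_injective (by simp [toSeries_mul])
    zero_mul := fun _ => toSeries_injective (by simp [toSeries_mul])
    mul_zero := fun _ => toSeries_injective (by simp [toSeries_mul]) }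

instance : IsScalarTower K (FreeZinbiel K) (FreeZinbiel K) :=
  ⟨fun _ _ _ => toSeries_injective (by simp [toSeries_mul])⟩

instance : SMulCommClass K (FreeZinbiel K) (FreeZinbiel K) :=
  ⟨fun _ _ _ => toSeries_injective (by simp [toSeries_mul])⟩

theorem isZinbiel : IsZinbiel (FreeZinbiel K) := fun a b c => toSeries_injective (by
  simp only [toSeries_mul, map_add]
  rw [half_half (by simp [aug_toSeries]), map_add, LinearMap.add_apply])

/-- The generator `t`. -/
def gen (t : Bool) : FreeZinbiel K := ⟨letter t, rfl, 1, letter_mem_degLE t⟩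

end FreeZinbiel

namespace MinusAlgebra

variable {K A : Type*} [Field K] [NonUnitalNonAssocRing A] [Module K A]

instance [IsScalarTower K A A] [SMulCommClass K A A] :
    IsScalarTower K (MinusAlgebra A) (MinusAlgebra A) :=
  ⟨fun c x y => of.symm.injective (by
    change (c • of.symm x) * of.symm y - of.symm y * (c • of.symm x) =
      c • (of.symm x * of.symm y - of.symm y * of.symm x)
    rw [smul_mul_assoc, mul_smul_comm, smul_sub])⟩

instance [IsScalarTower K A A] [SMulCommClass K A A] :
    SMulCommClass K (MinusAlgebra A) (MinusAlgebra A) :=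
  ⟨fun c x y => of.symm.injective (by
    change c • (of.symm x * of.symm y - of.symm y * of.symm x) =
      of.symm x * (c • of.symm y) - (c • of.symm y) * of.symm x
    rw [smul_mul_assoc, mul_smul_comm, smul_sub])⟩

end MinusAlgebra

namespace FreeZinbiel

variable {K : Type u} [Field K]

/-- The inclusion of the minus-algebra into the space of series. -/
def minusToSeries : MinusAlgebra (FreeZinbiel K) →ₗ[K] ShuffleSeries K where
  toFun a := toSeries (MinusAlgebra.of.symm a)
  map_add' _ _ := rfl
  map_smul' _ _ := rfl

theorem minusToSeries_injective :
    Function.Injective (minusToSeries : MinusAlgebra (FreeZinbiel K) → ShuffleSeries K) :=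
  fun _ _ h => MinusAlgebra.of.symm.injective (toSeries_injective h)

theorem minusToSeries_mul (a b : MinusAlgebra (FreeZinbiel K)) :
    minusToSeries (a * b) = area (minusToSeries a) (minusToSeries b) := rfl

theorem isTortkara : IsTortkara (MinusAlgebra (FreeZinbiel K)) where
  anticomm a b := minusToSeries_injective (by
    rw [map_neg, minusToSeries_mul, minusToSeries_mul, area_def, area_def, neg_sub])
  tortkara a b c := minusToSeries_injective (by
    have h : ∀ a : MinusAlgebra (FreeZinbiel K), aug (minusToSeries a) = 0 :=
      fun a => aug_toSeries (MinusAlgebra.of.symm a)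
    simp only [jacobian, minusToSeries_mul, map_add]
    have ha := h a
    have hb := h b
    have hc := h c
    generalize minusToSeries a = a at *
    generalize minusToSeries b = b at *
    generalize minusToSeries c = c at *
    -- The derivative of either side is the cyclic sum of [a, b] ∂c; the terms without brackets
    -- cancel.
    have hJ : area (area a b) c + area (area b c) a + area (area c a) b =
        a * area b c + b * area c a + c * area a b := by
      apply ext_der
      · simp
      · intro t; simp; ring
    have hcb : area c b = -area b c := by rw [area_def, area_def, neg_sub]
    apply ext_der
    · simp
    · intro t
      simp
      linear_combination (-der t b) * hJ + (b * der t a - a * der t b) * hcb)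

end FreeZinbiel
-- Linear independence of the left-normed monomials in the letters.
namespace ShuffleSeries

variable (K : Type u) [Field K]

/-- The series whose images under `curl` are the left-normed monomials in the letters. -/
def leftNormedCoeff : List Bool → ShuffleSeries K
  | [] => 1
  | t :: w => -(letter t * leftNormedCoeff w + app t (leftNormedCoeff w))

theorem leftNormedCoeff_mem_degLE (w : List Bool) : leftNormedCoeff K w ∈ degLE K w.length := by
  induction w with
  | nil => exact one_mem_degLE
  | cons t w ih =>
    have h1 := mul_mem_degLE (letter_mem_degLE t) ih
    rw [add_comm] at h1
    simpa [leftNormedCoeff] using neg_mem (add_mem h1 (app_mem_degLE t ih))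

/-- The part of a polynomial in the words ending with `t`, with that letter removed. -/
noncomputable def wordTail (t : Bool) : (List Bool →₀ K) →ₗ[K] (List Bool →₀ K) :=
  Finsupp.lcomapDomain (List.cons t) List.cons_injective

theorem wordTail_apply (t : Bool) (l : List Bool →₀ K) (w : List Bool) :
    wordTail K t l w = l (t :: w) := rfl

theorem linearCombination_leftNormedCoeff (l : List Bool →₀ K) :
    Finsupp.linearCombination K (leftNormedCoeff K) l =
      algebraMap K _ (l []) - ∑ t, (letter t * Finsupp.linearCombination K (leftNormedCoeff K)
          (wordTail K t l) +
        app t (Finsupp.linearCombination K (leftNormedCoeff K)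
          (wordTail K t l))) := by
  have hs : ∀ s t (w : List Bool) (c : K), wordTail K s (Finsupp.single (t :: w) c) =
        if s = t then Finsupp.single w c else 0 := by
    intro s t w c
    ext v
    rw [wordTail_apply]
    split_ifs with h
    · subst h; simp [Finsupp.single_apply]
    · simp [Ne.symm h]
  have h0 : ∀ s (c : K), wordTail K s (Finsupp.single [] c) = 0 := by
    intro s c
    ext v
    simp [wordTail_apply]
  induction l using Finsupp.induction_linear with
  | zero => simp
  | add f g hf hg =>
    rw [map_add, hf, hg]
    simp only [map_add, Finsupp.add_apply, mul_add, Fintype.sum_bool]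
    abel
  | single w c =>
    rcases w with - | ⟨t, w⟩
    · simp [h0, leftNormedCoeff, Algebra.algebraMap_eq_smul_one]
    · cases t <;> simp [hs, leftNormedCoeff]

variable [CharZero K]

theorem linearIndependent_leftNormedCoeff : LinearIndependent K (leftNormedCoeff K) := by
  rw [linearIndependent_iff]
  have hdeg : ∀ l : List Bool →₀ K, ∃ n : ℤ,
      Finsupp.linearCombination K (leftNormedCoeff K) l ∈ degLE K n := by
    intro l
    induction l using Finsupp.induction_linear with
    | zero => exact ⟨0, by simp⟩
    | add f g hf hg =>
      obtain ⟨⟨m, hm⟩, n, hn⟩ := And.intro hf hg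
      rw [map_add]
      exact ⟨max m n, add_mem (degLE_mono (le_max_left _ _) hm) (degLE_mono (le_max_right _ _) hn)⟩
    | single w c =>
      rw [Finsupp.linearCombination_single]
      exact ⟨w.length, Submodule.smul_mem _ _ (leftNormedCoeff_mem_degLE K w)⟩
  have hstep : ∀ l : List Bool →₀ K, Finsupp.linearCombination K (leftNormedCoeff K) l = 0 →
      l [] = 0 ∧ ∀ t, Finsupp.linearCombination K (leftNormedCoeff K)
        (wordTail K t l) = 0 := by
    intro l hl
    rw [linearCombination_leftNormedCoeff, Fintype.sum_bool] at hl
    obtain ⟨m, hm⟩ := hdeg (wordTail K true l)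
    obtain ⟨n, hn⟩ := hdeg (wordTail K false l)
    set a := Finsupp.linearCombination K (leftNormedCoeff K)
      (wordTail K true l)
    set b := Finsupp.linearCombination K (leftNormedCoeff K)
      (wordTail K false l)
    -- By `linearCombination_leftNormedCoeff`, the vanishing combination is E + 1 applied to this
    -- series, and E + 1 is injective on polynomials.
    have hz : algebraMap K _ (l []) - app true a - app false b = 0 := by
      refine eq_zero_of_euler_add_smul 0 (n := max (max m n + 1) 0) (sub_mem (sub_mem
        (degLE_mono (le_max_right _ _) (algebraMap_mem_degLE _))
        (degLE_mono ?_ (app_mem_degLE true hm))) (degLE_mono ?_ (app_mem_degLE false hn))) ?_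
      · omega
      · omega
      · rw [← hl]
        simp [euler_def]
        ring
    refine ⟨by simpa using congrArg aug hz, ?_⟩
    rintro (_ | _)
    · simpa using congrArg (der false) hz
    · simpa using congrArg (der true) hz
  intro l hl
  ext w
  induction w generalizing l with
  | nil => exact (hstep l hl).1
  | cons t w ih => exact ih _ ((hstep l hl).2 t)

end ShuffleSeries

/-! ### The graph of the homomorphism onto B, and the conclusion. -/

namespace FreeZinbiel

variable {K : Type u} [Field K] {B : Type v} [NonUnitalNonAssocRing B] [Module K B] (g : Bool → B)

/-- The pairs of corresponding generators of the free Zinbiel algebra and of `B`. -/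
def genPair (g : Bool → B) (t : Bool) : MinusAlgebra (FreeZinbiel K) × B :=
  (MinusAlgebra.of (gen t), g t)

/-- The projection of pairs to the space of series. -/
def fstSeries (K : Type u) (B : Type v) [Field K] [NonUnitalNonAssocRing B] [Module K B] :
    MinusAlgebra (FreeZinbiel K) × B →ₗ[K] ShuffleSeries K :=
  minusToSeries ∘ₗ LinearMap.fst K _ _

theorem fstSeries_mul (p q : MinusAlgebra (FreeZinbiel K) × B) :
    fstSeries K B (p * q) = area (fstSeries K B p) (fstSeries K B q) := rfl

theorem fstSeries_genPair (t : Bool) : fstSeries K B (genPair g t) = letter t := rfl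

theorem fstSeries_leftNormed (w : List Bool) :
    fstSeries K B (leftNormed (genPair g) w) = curl (leftNormedCoeff K w) := by
  induction w with
  | nil => exact area_letters
  | cons t w ih =>
    rw [leftNormed, fstSeries_mul, ih, fstSeries_genPair, area_curl_letter, leftNormedCoeff,
      map_neg]

theorem fstSeries_mem {p : MinusAlgebra (FreeZinbiel K) × B}
    (hp : p ∈ IsTortkara.generatedSpan K (genPair g)) :
    fstSeries K B p ∈ areaSubmodule K := by
  have : IsTortkara.generatedSpan K (genPair g) ≤ (areaSubmodule K).comap (fstSeries K B) := by
    refine Submodule.span_le.2 ?_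
    rintro _ (⟨t, rfl⟩ | ⟨w, rfl⟩)
    · exact letter_mem t
    · change fstSeries K B _ ∈ areaSubmodule K
      rw [fstSeries_leftNormed]
      exact curl_mem _
  exact this hp

variable [CharZero K]

/-- This makes the span of pairs a graph over its first projection: values of `curl` have no linear
part, so the generators drop out, and the images of the left-normed monomials are independent. -/
theorem eq_zero_of_fstSeries {p : MinusAlgebra (FreeZinbiel K) × B}
    (hp : p ∈ IsTortkara.generatedSpan K (genPair g)) (h : fstSeries K B p = 0) : p = 0 := by
  rw [IsTortkara.generatedSpan, Submodule.span_union, Submodule.mem_sup] at hp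
  obtain ⟨p, hp, q, hq, rfl⟩ := hp
  obtain ⟨c, rfl⟩ := (Submodule.mem_span_range_iff_exists_fun K).1 hp
  have hcurl : ∃ u, fstSeries K B q = curl u := by
    have : Submodule.span K (Set.range (leftNormed (genPair g))) ≤
        (LinearMap.range (curl (K := K))).comap (fstSeries K B) := by
      refine Submodule.span_le.2 ?_
      rintro _ ⟨w, rfl⟩
      exact ⟨_, (fstSeries_leftNormed g w).symm⟩
    obtain ⟨u, hu⟩ := this hq
    exact ⟨u, hu.symm⟩
  obtain ⟨u, hu⟩ := hcurl
  have hli : LinearIndependent K (fstSeries K B ∘ leftNormed (genPair g)) := by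
    have : fstSeries K B ∘ leftNormed (genPair g) = curl ∘ leftNormedCoeff K :=
      funext (fstSeries_leftNormed g)
    rw [this]
    exact (linearIndependent_leftNormedCoeff K).map' curl
      (LinearMap.ker_eq_bot.2 curl_injective)
  simp only [Fintype.sum_bool, map_add, map_smul, fstSeries_genPair, hu] at h ⊢
  have h1 := congrArg (fun f => aug (der true f)) h
  have h2 := congrArg (fun f => aug (der false f)) h
  simp at h1 h2
  rw [h1, h2, zero_smul, zero_smul, zero_add, zero_add] at h ⊢
  exact Submodule.disjoint_def.1 (Submodule.range_ker_disjoint hli) q hq (hu.trans h)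

variable [IsScalarTower K B B] [SMulCommClass K B B] (hB : IsTortkara B)

include hB

/-- Writing u = (E + 1)z, right multiplication by the generators realizes the terms coming from the
derivatives of z, which have smaller degree, and [x, y] realizes the constant term. -/
theorem exists_fstSeries_curl (m : ℕ) : ∀ {u : ShuffleSeries K}, u ∈ degLE K m →
    ∃ p ∈ IsTortkara.generatedSpan K (genPair g), fstSeries K B p = curl u := by
  have hconst : ∀ c : K, ∃ p ∈ IsTortkara.generatedSpan K (genPair g),
      fstSeries K B p = curl (algebraMap K _ c) := fun c =>
    ⟨c • leftNormed (genPair g) [],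
      Submodule.smul_mem _ _ (Submodule.subset_span (Or.inr ⟨[], rfl⟩)), by
      rw [map_smul, fstSeries_leftNormed, ← map_smul, Algebra.algebraMap_eq_smul_one,
        leftNormedCoeff]⟩
  induction m with
  | zero =>
    intro u hu
    rw [eq_algebraMap_of_mem_degLE_zero hu]
    exact hconst _
  | succ m ih =>
    intro u hu
    obtain ⟨z, hz, rfl⟩ := exists_euler_add_smul 0 hu
    have hder : ∀ t, ∃ p ∈ IsTortkara.generatedSpan K (genPair g),
        fstSeries K B p = curl (letter t * der t z + app t (der t z)) := by
      intro t
      have hz' := der_mem_degLE t hz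
      push_cast at hz'
      rw [add_sub_cancel_right] at hz'
      obtain ⟨p, hp, e⟩ := ih hz'
      refine ⟨-(p * genPair g t), neg_mem (isTortkara.prod hB |>.generatedSpan_mul_mem _ hp
        (Submodule.subset_span (Or.inl ⟨t, rfl⟩))), ?_⟩
      rw [map_neg, fstSeries_mul, e, fstSeries_genPair, area_curl_letter, neg_neg]
    obtain ⟨p, hp, ep⟩ := hconst (aug z)
    obtain ⟨q, hq, eq⟩ := hder true
    obtain ⟨r, hr, er⟩ := hder false
    refine ⟨p + q + r, add_mem (add_mem hp hq) hr, ?_⟩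
    rw [map_add, map_add, ep, eq, er, ← map_add, ← map_add]
    congr 1
    simp only [euler_def, zero_add, Nat.cast_one, one_smul]
    linear_combination -eq_sum_app z

theorem exists_fstSeries {n : ℤ} {l : ShuffleSeries K} (hl : l ∈ areaSubmodule K)
    (hn : l ∈ degLE K n) :
    ∃ p ∈ IsTortkara.generatedSpan K (genPair g), fstSeries K B p = l := by
  have hd : der true (der false l) ∈ degLE K n.toNat :=
    degLE_mono (by omega) (der_mem_degLE true (der_mem_degLE false hn))
  obtain ⟨p, hp, e⟩ := exists_fstSeries_curl g hB _ hd
  have hg : ∀ t, genPair g t ∈ IsTortkara.generatedSpan K (genPair (K := K) g) := fun t =>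
    Submodule.subset_span (Or.inl ⟨t, rfl⟩)
  refine ⟨aug (der true l) • genPair g true + aug (der false l) • genPair g false + p,
    add_mem (add_mem (Submodule.smul_mem _ _ (hg _)) (Submodule.smul_mem _ _ (hg _))) hp, ?_⟩
  conv_rhs => rw [eq_curl_of_mem hl]
  simp only [map_add, map_smul, fstSeries_genPair, e]

theorem isSpecial_of_generators (hx : g true ≠ 0)
    (hgen : NonUnitalAlgebra.adjoin K (Set.range g) = ⊤) : IsSpecial K B := by
  set W := IsTortkara.generatedSpan K (genPair (K := K) g) with hWdef
  have hg : ∀ t, genPair g t ∈ W := fun t => Submodule.subset_span (Or.inl ⟨t, rfl⟩)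
  have hW : ∀ p ∈ W, ∀ q ∈ W, p * q ∈ W := fun p hp q hq =>
    (isTortkara.prod hB).generatedSpan_mul_mem _ hp hq
  have hsurj : ∀ b, ∃ p ∈ W, p.2 = b := by
    intro b
    have hb : b ∈ NonUnitalAlgebra.adjoin K (Set.range g) := hgen ▸ NonUnitalAlgebra.mem_top
    induction hb using NonUnitalAlgebra.adjoin_induction with
    | mem b hb => obtain ⟨t, rfl⟩ := hb; exact ⟨_, hg t, rfl⟩
    | add a b _ _ ha hb =>
      obtain ⟨⟨p, hp, rfl⟩, q, hq, rfl⟩ := And.intro ha hb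
      exact ⟨p + q, add_mem hp hq, rfl⟩
    | zero => exact ⟨0, zero_mem _, rfl⟩
    | mul a b _ _ ha hb =>
      obtain ⟨⟨p, hp, rfl⟩, q, hq, rfl⟩ := And.intro ha hb
      exact ⟨p * q, hW p hp q hq, rfl⟩
    | smul c a _ ha =>
      obtain ⟨p, hp, rfl⟩ := ha
      exact ⟨c • p, Submodule.smul_mem _ c hp, rfl⟩
  have hinj : ∀ p ∈ W, ∀ q ∈ W, fstSeries K B p = fstSeries K B q → p = q :=
    fun p hp q hq h => sub_eq_zero.1 (eq_zero_of_fstSeries g (sub_mem hp hq) (by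
      rw [map_sub, h, sub_self]))
  -- The kernel of the homomorphism onto B, seen inside the series.
  let I : Submodule K (ShuffleSeries K) :=
    (W ⊓ LinearMap.ker (LinearMap.snd K (MinusAlgebra (FreeZinbiel K)) B)).map (fstSeries K B)
  have hmemI : ∀ p ∈ W, fstSeries K B p ∈ I ↔ p.2 = 0 := fun p hp => by
    constructor
    · rintro ⟨q, ⟨hqW, hq2⟩, hq⟩
      rw [← hinj q hqW p hp hq]
      exact hq2
    · exact fun h => ⟨p, ⟨hp, h⟩, rfl⟩
  have hI : IsAreaIdeal I := by
    constructor
    · rintro _ ⟨p, ⟨hp, -⟩, rfl⟩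
      exact fstSeries_mem g hp
    · rintro n l _ hl hn ⟨p, ⟨hp, hp2⟩, rfl⟩
      obtain ⟨q, hq, rfl⟩ := exists_fstSeries g hB hl hn
      rw [← fstSeries_mul, hmemI _ (hW q hq p hp)]
      have : p.2 = 0 := hp2
      rw [Prod.snd_mul, this, mul_zero]
  have hxI : letter true ∉ I := by
    rw [← fstSeries_genPair (K := K) g true, hmemI _ (hg true)]
    exact hx
  let N : Submodule K (FreeZinbiel K) :=
    { carrier := {a | ∃ n : ℤ, toSeries a ∈ shuffleIdeal I n}
      add_mem' := fun {a b} ⟨m, hm⟩ ⟨n, hn⟩ => ⟨max m n, by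
        rw [map_add]
        exact add_mem (shuffleIdeal_mono (le_max_left _ _) hm)
          (shuffleIdeal_mono (le_max_right _ _) hn)⟩
      zero_mem' := ⟨0, by rw [map_zero]; exact zero_mem _⟩
      smul_mem' := fun c a ⟨n, hn⟩ => ⟨n, by rw [map_smul]; exact Submodule.smul_mem _ c hn⟩ }
  -- By definition p ∘ a is the sum over t of p ∂ₜa with t appended, so stability under appending a
  -- letter suffices. The other side follows below from a ∘ p = a p - p ∘ a.
  have hhalf : ∀ {m n : ℤ} {p a : ShuffleSeries K}, p ∈ shuffleIdeal I m → a ∈ degLE K n →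
      half p a ∈ shuffleIdeal I (n + m) := fun {m n p a} hp ha => by
    have h : ∀ t, app t (p * der t a) ∈ shuffleIdeal I (n + m) := fun t => by
      have := hI.app_mem t (mul_shuffleIdeal (der_mem_degLE t ha) hp)
      rw [show n - 1 + m + 1 = n + m by ring] at this
      rwa [mul_comm]
    exact add_mem (h true) (h false)
  refine isSpecial_of_graph isZinbiel W hW hsurj N ?_ ?_ ?_
  · rintro a p ⟨m, hm⟩
    obtain ⟨n, hn⟩ := a.2.2
    refine ⟨n + m, ?_⟩
    rw [toSeries_mul, ← add_sub_cancel_right (half _ _) (half (toSeries p) (toSeries a)),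
      half_add_half_swap (by simp [aug_toSeries])]
    exact sub_mem (mul_shuffleIdeal hn hm) (hhalf hm hn)
  · rintro p ⟨m, hm⟩ a
    obtain ⟨n, hn⟩ := a.2.2
    exact ⟨n + m, hhalf hm hn⟩
  · intro p hp
    rw [← hmemI p hp]
    constructor
    · rintro ⟨n, hn⟩
      exact hI.mem_of_mem_shuffleIdeal hxI hn (fstSeries_mem g hp)
    · intro h
      obtain ⟨n, hn⟩ := (MinusAlgebra.of.symm p.1 : FreeZinbiel K).2.2
      exact ⟨n, mem_shuffleIdeal h hn⟩

end FreeZinbiel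

theorem mainTheorem5 (K : Type u) (B : Type v) [Field K] [CharZero K]
    [NonUnitalNonAssocRing B] [Module K B] [IsScalarTower K B B] [SMulCommClass K B B]
    (hB : IsTortkara B)
    (hgen : ∃ x y : B, NonUnitalAlgebra.adjoin K ({x, y} : Set B) = ⊤) :
    IsSpecial K B := by
  obtain ⟨x, y, h⟩ := hgen
  have hrange : ∀ x y : B, Set.range (fun t : Bool => bif t then x else y) = {x, y} := fun x y => by
    ext b
    simp [eq_comm, or_comm]
  -- The argument needs the generator named `true` to be nonzero; the generators are swapped if
  -- necessary, and if both vanish then B = 0.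
  by_cases hx : x = 0
  · by_cases hy : y = 0
    · have hB0 : ∀ b : B, b = 0 := fun b => by
        have hb : b ∈ NonUnitalAlgebra.adjoin K ({x, y} : Set B) := h ▸ NonUnitalAlgebra.mem_top
        have hle : NonUnitalAlgebra.adjoin K ({x, y} : Set B) ≤ ⊥ :=
          NonUnitalAlgebra.adjoin_le (by rw [hx, hy]; simp)
        exact NonUnitalAlgebra.mem_bot.1 (hle hb)
      refine ⟨PUnit, inferInstance, inferInstance, inferInstance, inferInstance, fun _ _ _ => rfl,
        0, fun a b _ => (hB0 a).trans (hB0 b).symm⟩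
    · exact FreeZinbiel.isSpecial_of_generators (fun t => bif t then y else x) hB hy
        (by rw [hrange, Set.pair_comm, h])
  · exact FreeZinbiel.isSpecial_of_generators (fun t => bif t then x else y) hB hx
      (by rw [hrange, h])
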